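/- Let $F=\mathbf Z/2$. Let $V$ be an $F$-vector space with a symplectic (that is, alternating, possibly degenerate) form $\langle,\rangle:V\times V\to F$ and a map $e:S\to V$, $s\mapsto e_s$, where $S$ is a finite set. Join $s\neq s'$ in $S$ by an edge when $\langle e_s,e_{s'}\rangle=1$; this makes $S$ the vertex set of a graph. For $I\subset S$ put $e_I=\sum_{s\in I}e_s$ and let $\underline I$ be the full subgraph on $I$. Let $\mathcal I^1$ be the set of $I\subset S$ with $|I|$ odd such that $\underline I$ is a graph of type $A_m$ (a path with $m$ vertices) for some $m\ge 1$. For $I,I'\in\mathcal I^1$ write $I\prec I'$ if $I\subsetneq I'$ and $\underline{I'-I}$ is disconnected, and $I\spadesuit I'$ if $I\cap I'=\emptyset$ and $\underline{I\cup I'}$ is disconnected. For $I\in\mathcal I^1$ let $I^{ev}$ be the set of $s\in I$ such that $I-\{s\}=I'\sqcup I''$ with $I',I''\in\mathcal I^1$, $I'\spadesuit I''$. Let $R$ be the set of subsets of $\mathcal I^1$. For $B\in R$ let $L_B$ be the span of $\{e_I: I\in B\}$ in $V$, and for $s\in S$ let $g_s(B)=|\{I\in B: s\in I\}|$. Put $\varepsilon(B)=\sum_{s\in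 S}\tfrac12 g_s(B)(g_s(B)+1)e_s\in V$. For a subspace $L\subset V$ let $B_L=\{I\in\mathcal I^1: e_I\in L\}$. Let $\varphi(V)$ be the set of $B\in R$ such that $(P_0)$ for any $I,I'\in B$ we have $I=I'$ or $I\spadesuit I'$ or $I\prec I'$ or $I'\prec I$; $(P_1)$ for any $I\in B$ there are pairwise disjoint $I_1,\dots,I_k\in B$ ($k\ge0$) with $I_j\prec I$ for all $j$ and $I^{ev}\subset I_1\sqcup\dots\sqcup I_k$. Put $V_0=\bigcup_{B\in\varphi(V)}L_B$. We say that $(V,\langle,\rangle,e)$ is *perfect* if: (i) for $B\in\varphi(V)$ the vectors $e_I$ $(I\in B)$ form a basis of $L_B$, and $B=B_{L_B}$; (ii) $\varepsilon(B)\in L_B$ for $B\in\varphi(V)$; (iii) $\varepsilon$ restricts to a bijection $\varphi(V)\to V_0$; (iv) if $B,B'\in\varphi(V)$ and $\varepsilon(B')\in L_B$, then $g_s(B')\le g_s(B)$ for all $s\in S$. **Theorem 1.4.** Let $N\ge3$ be odd. Then $(V,\langle,\rangle,e)$ is perfect in each of the following cases: (a) $\{e_s: s\in S\}$ is a basis of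 $V$ and the graph is of type $A_{N-1}$ (a path with $N-1$ vertices); (b) $\{e_s: s\in S\}$ is a basis of $V$ and the graph is of affine type $A_{N-1}$ (a cycle with $N$ vertices); (c) $(V,\langle,\rangle,e)$ is replaced by $(\bar V,\langle,\rangle,\bar e)$ where $V,\langle,\rangle,e$ are as in (b), $\bar V=V/Fe_S$ with the induced symplectic form, and $\bar e_s$ is the image of $e_s$ in $\bar V$. In this case, moreover, $V_0$ (formed for $\bar V$) equals $\bar V$. In case (c) the following also holds. Let $\mathcal F(\bar V)$ be the family of subspaces of $\bar V$ defined by induction on $N$ as follows. For $s\in S$ let $\hat s=\{s'\in S:\langle\bar e_s,\bar e_{s'}\rangle=1\}\cup\{s\}$, $\bar e_s^\perp=\{x\in\bar V:\langle x,\bar e_s\rangle=0\}$, $\bar V_s=\bar e_s^\perp/F\bar e_s$ and let $\bar p_s:\bar e_s^\perp\to\bar V_s$ be the obvious map. If $N=3$, $\mathcal F(\bar V)$ consists of $0$ and of the $\bar p_s^{-1}(0)$, $s\in S$. If $N\ge5$, $\bar V_s$ is a space of the same kind as $\bar V$ with $N$ replaced by $N-2$, with respect to the images of $\bar e_{s'}$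 $(s'\in S-\hat s)$ and of $\sum_{s'\in\hat s}\bar e_{s'}$, and $\mathcal F(\bar V)$ consists of $0$ and of the $\bar p_s^{-1}(L')$ with $s\in S$, $L'\in\mathcal F(\bar V_s)$. Then: - $B\mapsto L_B$ is a bijection $\varphi(\bar V)\to\mathcal F(\bar V)$; - there is a unique bijection $f:\mathcal F(\bar V)\to\bar V$ such that $f(L)\in L$ for all $L\in\mathcal F(\bar V)$, and it satisfies $f(L_B)=\varepsilon(B)$ for all $B\in\varphi(\bar V)$; - for every automorphism $\sigma$ of the cyclic graph on $S$ there is a linear automorphism $T$ of $\bar V$ with $T(\bar e_s)=\bar e_{\sigma(s)}$ for all $s\in S$, and for all $B\in\varphi(\bar V)$ we have $\sigma(B)\in\varphi(\bar V)$, $L_{\sigma(B)}=T(L_B)$ and $\varepsilon(\sigma(B))=T(\varepsilon(B))$. -/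

import Mathlib

/-- A triple `(V, ⟨,⟩, e)`: an `F`-vector space `V` (where `F = ℤ/2`) with a symplectic
(i.e. alternating, possibly degenerate) form and a map `e : S → V`. -/
structure SymplecticTriple (S : Type*) (V : Type*) [AddCommGroup V] [Module (ZMod 2) V] where
  form : V →ₗ[ZMod 2] V →ₗ[ZMod 2] ZMod 2
  alt : form.IsAlt
  e : S → V

namespace SymplecticTriple

universe u v

section Basic

variable {S : Type*} {V : Type*} [AddCommGroup V] [Module (ZMod 2) V]

/-- The graph `(S, 𝔈)`: two distinct vertices `s, s'` are joined iff `⟨e_s, e_{s'}⟩ = 1`. -/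
def graph (D : SymplecticTriple S V) : SimpleGraph S where
  Adj s t := s ≠ t ∧ D.form (D.e s) (D.e t) = 1
  symm := ⟨fun s t h => ⟨h.1.symm, by
    have h1 := D.alt.neg (D.e s) (D.e t)
    rw [ZMod.neg_eq_self_mod_two] at h1
    rw [← h1]; exact h.2⟩⟩
  loopless := ⟨fun _ h => h.1 rfl⟩

/-- `e_I = ∑_{s ∈ I} e_s`. -/
def vec (D : SymplecticTriple S V) (I : Finset S) : V := ∑ s ∈ I, D.e s

/-- `I ∈ 𝓘`: the full subgraph with vertex set `I` is a graph of type `A_m` for some `m ≥ 1`. -/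
def IsTypeA (D : SymplecticTriple S V) (I : Finset S) : Prop :=
  ∃ m : ℕ, 1 ≤ m ∧ Nonempty (D.graph.induce (I : Set S) ≃g SimpleGraph.pathGraph m)

/-- The set `𝓘¹` of all `I ∈ 𝓘` with `|I|` odd. -/
def oddIntervals (D : SymplecticTriple S V) : Set (Finset S) :=
  {I | D.IsTypeA I ∧ Odd I.card}

/-- The full subgraph with vertex set `I` is disconnected. -/
def Disconnected (D : SymplecticTriple S V) (I : Set S) : Prop :=
  ¬ (D.graph.induce I).Connected

/-- `I ≺ I'`: `I ⊊ I'` and the full subgraph on `I' - I` is disconnected. -/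
def Prec (D : SymplecticTriple S V) (I I' : Finset S) : Prop :=
  I ⊂ I' ∧ D.Disconnected ((I' : Set S) \ (I : Set S))

/-- `I ♠ I'`: `I ∩ I' = ∅` and the full subgraph on `I ∪ I'` is disconnected. -/
def Spade (D : SymplecticTriple S V) (I I' : Finset S) : Prop :=
  Disjoint I I' ∧ D.Disconnected ((I : Set S) ∪ (I' : Set S))

/-- `I^{ev}`: all `s ∈ I` such that `I - {s} = I' ⊔ I''` with `I', I'' ∈ 𝓘¹`, `I' ♠ I''`. -/
def evenPart (D : SymplecticTriple S V) (I : Finset S) : Set S :=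
  {s | s ∈ I ∧ ∃ I' ∈ D.oddIntervals, ∃ I'' ∈ D.oddIntervals,
    D.Spade I' I'' ∧ (I : Set S) \ {s} = (I' : Set S) ∪ (I'' : Set S)}

/-- Condition `(P₀)`. -/
def P0 (D : SymplecticTriple S V) (B : Finset (Finset S)) : Prop :=
  ∀ I ∈ B, ∀ I' ∈ B, I = I' ∨ D.Spade I I' ∨ D.Prec I I' ∨ D.Prec I' I

/-- Condition `(P₁)`; `C` is the collection `{I_1, …, I_k}` of pairwise disjoint sets. -/
def P1 (D : SymplecticTriple S V) (B : Finset (Finset S)) : Prop :=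
  ∀ I ∈ B, ∃ C : Finset (Finset S), C ⊆ B ∧
    (∀ J ∈ C, ∀ K ∈ C, J ≠ K → Disjoint J K) ∧
    (∀ J ∈ C, D.Prec J I) ∧
    D.evenPart I ⊆ ⋃ J ∈ C, (J : Set S)

/-- The set `φ(V)` of all finite collections `B` of elements of `𝓘¹` that satisfy `(P₀)` and
`(P₁)`. -/
def phi (D : SymplecticTriple S V) : Set (Finset (Finset S)) :=
  {B | (∀ I ∈ B, I ∈ D.oddIntervals) ∧ D.P0 B ∧ D.P1 B}

/-- `L_B`, the subspace of `V` generated by the `e_I`, `I ∈ B`. -/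
def span (D : SymplecticTriple S V) (B : Finset (Finset S)) : Submodule (ZMod 2) V :=
  Submodule.span (ZMod 2) (D.vec '' (B : Set (Finset S)))

/-- `B_L = {I ∈ 𝓘¹ ; e_I ∈ L}`. -/
def members (D : SymplecticTriple S V) (L : Submodule (ZMod 2) V) : Set (Finset S) :=
  {I | I ∈ D.oddIntervals ∧ D.vec I ∈ L}

/-- `V₀`, the union of the `L_B`, `B ∈ φ(V)`. -/
def V0 (D : SymplecticTriple S V) : Set V := ⋃ B ∈ D.phi, (D.span B : Set V)

/-- `g_s(B)`, the number of `I ∈ B` that contain `s`. -/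
def g [DecidableEq S] (s : S) (B : Finset (Finset S)) : ℕ := (B.filter (fun I => s ∈ I)).card

/-- `ε(B) = ∑_s ½ g_s(B) (g_s(B) + 1) e_s`; the division by `2` is exact. -/
def eps [Fintype S] [DecidableEq S] (D : SymplecticTriple S V) (B : Finset (Finset S)) : V :=
  ∑ s : S, ((g s B * (g s B + 1) / 2 : ℕ) : ZMod 2) • D.e s

/-- `(V, ⟨,⟩, e)` is perfect: properties (i)-(iv). -/
structure Perfect [Fintype S] [DecidableEq S] (D : SymplecticTriple S V) : Prop where
  /-- (i): the `e_I`, `I ∈ B`, are linearly independent, hence a basis of the space `L_B` that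
  they generate. -/
  basis : ∀ B ∈ D.phi, LinearIndependent (ZMod 2) (fun I : {I // I ∈ B} => D.vec I.1)
  /-- (i): `B = B_{L_B}`. -/
  eq_members : ∀ B ∈ D.phi, (B : Set (Finset S)) = D.members (D.span B)
  /-- (ii) -/
  eps_mem : ∀ B ∈ D.phi, D.eps B ∈ D.span B
  /-- (iii) -/
  bijOn : Set.BijOn D.eps D.phi D.V0
  /-- (iv) -/
  g_le : ∀ B ∈ D.phi, ∀ B' ∈ D.phi, D.eps B' ∈ D.span B → ∀ s : S, g s B' ≤ g s B

/-- `{e_s ; s ∈ S}` is a basis of `V` and `(S, 𝔈)` is a graph of type `A_{N-1}`, with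
`N ∈ {3, 5, 7, …}`. -/
structure LinearCase (D : SymplecticTriple S V) (N : ℕ) : Prop where
  odd : Odd N
  three_le : 3 ≤ N
  indep : LinearIndependent (ZMod 2) D.e
  spans : ⊤ ≤ Submodule.span (ZMod 2) (Set.range D.e)
  iso : Nonempty (D.graph ≃g SimpleGraph.pathGraph (N - 1))

/-- `{e_s ; s ∈ S}` is a basis of `V` and `(S, 𝔈)` is a graph of affine type `A_{N-1}`
(a cycle with `N` vertices), with `N ∈ {3, 5, 7, …}`. -/
structure CyclicCase (D : SymplecticTriple S V) (N : ℕ) : Prop where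
  odd : Odd N
  three_le : 3 ≤ N
  indep : LinearIndependent (ZMod 2) D.e
  spans : ⊤ ≤ Submodule.span (ZMod 2) (Set.range D.e)
  iso : Nonempty (D.graph ≃g SimpleGraph.cycleGraph N)

end Basic

section Quotient

variable {V : Type*} [AddCommGroup V] [Module (ZMod 2) V]

/-- The form induced on `V/K` by an alternating form whose radical contains `K`. -/
def quotForm (b : V →ₗ[ZMod 2] V →ₗ[ZMod 2] ZMod 2) (hb : b.IsAlt)
    (K : Submodule (ZMod 2) V) (hK : K ≤ LinearMap.ker b) :
    (V ⧸ K) →ₗ[ZMod 2] (V ⧸ K) →ₗ[ZMod 2] ZMod 2 :=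
  b.liftQ₂ K K hK (hb.isRefl.ker_flip ▸ hK)

theorem quotForm_mk (b : V →ₗ[ZMod 2] V →ₗ[ZMod 2] ZMod 2) (hb : b.IsAlt)
    (K : Submodule (ZMod 2) V) (hK : K ≤ LinearMap.ker b) (x y : V) :
    quotForm b hb K hK (K.mkQ x) (K.mkQ y) = b x y := rfl

theorem quotForm_isAlt (b : V →ₗ[ZMod 2] V →ₗ[ZMod 2] ZMod 2) (hb : b.IsAlt)
    (K : Submodule (ZMod 2) V) (hK : K ≤ LinearMap.ker b) : (quotForm b hb K hK).IsAlt := by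
  intro x
  obtain ⟨x, rfl⟩ := K.mkQ_surjective x
  exact (quotForm_mk b hb K hK x x).trans (hb x)

end Quotient

section Bar

variable {S : Type*} {V : Type*} [Fintype S] [DecidableEq S] [AddCommGroup V]
  [Module (ZMod 2) V] {D : SymplecticTriple S V} {N : ℕ}

/-- In the cyclic case `e_S` lies in the radical of the form: each vertex has two neighbours. -/
theorem CyclicCase.vec_univ_mem_ker (h : D.CyclicCase N) :
    Submodule.span (ZMod 2) {D.vec Finset.univ} ≤ LinearMap.ker D.form := by
  classical
  rw [Submodule.span_singleton_le_iff_mem, LinearMap.mem_ker]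
  obtain ⟨φ⟩ := h.iso
  obtain ⟨n, rfl⟩ := Nat.exists_eq_add_of_le' h.three_le
  refine LinearMap.ext_on_range (v := D.e) (top_le_iff.mp h.spans) fun t => ?_
  have hdeg : D.graph.degree t = 2 := by
    rw [← φ.degree_eq t]; exact SimpleGraph.cycleGraph_degree_three_le
  have hval : ∀ s, D.form (D.e s) (D.e t) = if D.graph.Adj t s then 1 else 0 := by
    intro s
    rw [SimpleGraph.adj_comm]
    by_cases hst : s = t
    · subst hst; simpa using D.alt (D.e s)
    · by_cases h1 : D.form (D.e s) (D.e t) = 1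
      · rw [if_pos ⟨hst, h1⟩, h1]
      · rw [if_neg (fun h2 => h1 h2.2)]
        generalize D.form (D.e s) (D.e t) = a at h1
        revert a; decide
  simp only [vec, map_sum, LinearMap.sum_apply, hval, LinearMap.zero_apply]
  rw [Finset.sum_boole, ← SimpleGraph.neighborFinset_eq_filter, SimpleGraph.card_neighborFinset_eq_degree, hdeg]
  rfl

/-- The triple `(V̄, ⟨,⟩, π e)` with `V̄ = V / F e_S` and the induced form. -/
def CyclicCase.bar (h : D.CyclicCase N) :
    SymplecticTriple S (V ⧸ Submodule.span (ZMod 2) {D.vec Finset.univ}) where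
  form := quotForm D.form D.alt _ h.vec_univ_mem_ker
  alt := quotForm_isAlt _ _ _ _
  e s := Submodule.mkQ _ (D.e s)

end Bar

section Family

variable {S : Type v} {V : Type u} [AddCommGroup V] [Module (ZMod 2) V]

/-- `ŝ = {s' ; ⟨e_s, e_{s'}⟩ = 1} ∪ {s}`. -/
def hat [Fintype S] [DecidableEq S] (D : SymplecticTriple S V) (s : S) : Finset S :=
  Finset.univ.filter (fun t => D.form (D.e s) (D.e t) = 1) ∪ {s}

/-- `e_s^⊥ = {x ; ⟨x, e_s⟩ = 0}`. -/
def perp (D : SymplecticTriple S V) (s : S) : Submodule (ZMod 2) V :=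
  LinearMap.ker (D.form.flip (D.e s))

/-- The line `F e_s`, as a subspace of `e_s^⊥`. -/
def line (D : SymplecticTriple S V) (s : S) : Submodule (ZMod 2) (D.perp s) :=
  (Submodule.span (ZMod 2) {D.e s}).comap (D.perp s).subtype

/-- The form restricted to `e_s^⊥`. -/
def perpForm (D : SymplecticTriple S V) (s : S) :
    D.perp s →ₗ[ZMod 2] D.perp s →ₗ[ZMod 2] ZMod 2 :=
  D.form.compl₁₂ (D.perp s).subtype (D.perp s).subtype

theorem perpForm_isAlt (D : SymplecticTriple S V) (s : S) : (D.perpForm s).IsAlt :=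
  fun x => D.alt x.1

theorem line_le_ker (D : SymplecticTriple S V) (s : S) :
    D.line s ≤ LinearMap.ker (D.perpForm s) := by
  intro x hx
  obtain ⟨a, ha⟩ := Submodule.mem_span_singleton.mp (Submodule.mem_comap.mp hx)
  refine LinearMap.ext fun y => ?_
  have hy : D.form y.1 (D.e s) = 0 := y.2
  have h2 : D.form (D.e s) y.1 = 0 := D.alt.isRefl _ _ hy
  change D.form x.1 y.1 = 0
  have ha' : a • D.e s = x.1 := ha
  rw [← ha', map_smul, LinearMap.smul_apply, h2, smul_zero]

open Classical in
/-- `V_s = e_s^⊥ / F e_s` with the induced form and with the circular basis indexed by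
`S_s = (S - ŝ) ⊔ {ŝ}` consisting of the images of the `e_{s'}`, `s' ∈ S - ŝ`, and of `e_ŝ`
(here `none` stands for `ŝ`). These vectors do lie in `e_s^⊥` when `e` is a circular basis; the
value `0` is a placeholder that is never used in that case. -/
noncomputable def reduce [Fintype S] [DecidableEq S] (D : SymplecticTriple S V) (s : S) :
    SymplecticTriple (Option {t : S // t ∉ D.hat s}) (D.perp s ⧸ D.line s) where
  form := quotForm (D.perpForm s) (D.perpForm_isAlt s) (D.line s) (D.line_le_ker s)
  alt := quotForm_isAlt _ _ _ _
  e j :=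
    let x : V := j.elim (D.vec (D.hat s)) (fun t => D.e t.1)
    if hx : x ∈ D.perp s then (D.line s).mkQ ⟨x, hx⟩ else 0

/-- The inverse image `p̄_s⁻¹(L')` of a subspace `L'` of `V_s` under the map
`p̄_s : e_s^⊥ → V_s`, as a subspace of `V`. -/
def pull (D : SymplecticTriple S V) (s : S)
    (L' : Submodule (ZMod 2) (D.perp s ⧸ D.line s)) : Submodule (ZMod 2) V :=
  (L'.comap (D.line s).mkQ).map (D.perp s).subtype

end Family

/-- The inductively defined family `𝓕(V̄)` of subspaces of a symplectic space with a circular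
basis indexed by a set with `2 k + 3` elements. If `k = 0` it consists of `0` and of the
`p̄_s⁻¹(0)`; if `k ≥ 1` it consists of `0` and of the `p̄_s⁻¹(L')` with `L' ∈ 𝓕(V̄_s)`. -/
noncomputable def family : (k : ℕ) → {S : Type v} → {V : Type u} → [Fintype S] →
    [DecidableEq S] → [AddCommGroup V] → [Module (ZMod 2) V] → SymplecticTriple S V →
    Set (Submodule (ZMod 2) V)
  | 0, _, _, _, _, _, _, D => {L | L = ⊥ ∨ ∃ s, L = D.pull s ⊥}
  | k + 1, _, _, _, _, _, _, D =>
      {L | L = ⊥ ∨ ∃ s, ∃ L' ∈ family k (D.reduce s), L = D.pull s L'}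

end SymplecticTriple

/-!
The graph in cases (b) and (c) is a cycle with an odd number `N` of vertices; it is oriented by a
cyclic permutation `c` of `S`. The sets in `𝓘¹` are then the proper arcs of odd cardinality, `♠`
means that two arcs neither meet nor touch, and `≺` means that one arc lies in the other together
with its neighbours (`IsArc`, `Apart`, `Inside`).

**Height functions.** A family `B` satisfying `(P₀)` satisfies `(P₁)` if and only if `s ↦ g_s(B)` is
a height function: along each edge of the cycle it changes by `±1`, or it is zero at both ends
(`IsCircular.mem_phi_iff`). The members of `B` are then the components of the sets `{g(B) > d}`,
and conversely any nonnegative height function `h` is `g(B)` for the family `B` of these components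
(`IsAdmissible.ofHeight_g`, `isAdmissible_ofHeight`). So `φ(V)` is the set of nonnegative height
functions, and `ε` sends `h` to `∑ T(h_s) e_s`, where `T(k) = ½ k (k + 1)` modulo `2`.

**Injectivity.** We have `T(-1 - k) = T(k)`, and `k`, `-1 - k` have opposite parities. Choosing at
the `i`-th step of a walk around the cycle the one of `h` and `-1 - h` with the parity of `i`, one
turns a height function into a walk with steps `±1`, which after one turn comes back reflected in
`-1/2`, because `N` is odd. Knowing `T` along such a walk up to a constant determines the walk, so
that two height functions, of any sign, whose values of `T` differ by a constant are equal up to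
`y ↔ -1 - y` at each point (`IsHeight.eq_or_eq`). Conversely every function `S → ℤ/2` is `T(h) + const`
for a nonnegative height function `h` (`exists_isHeight`).

**Comparison.** A vector `∑ r_I e_I` of `L_B` has the coefficients `T(y_s)` for the signed height
function `y_s = ∑ ±1`, the sum being over the `I ∈ B` that contain `s`, with suitable signs
(`IsAdmissible.exists_height`). As `|y| ≤ g(B)`, property (iv) follows from uniqueness. Since the
depths of the members through `s` are `1, …, g_s(B)`, one has `ε(B) = ∑ depth(I) e_I ∈ L_B`
(`eps_eq_sum_depth`). This gives perfectness whenever the only possible linear relation between the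
`e_s` is `∑ e_s = 0` (`IsCircular.perfect`), which covers (b) and (c).

**The linear case.** Adjoining to a path the vector `∑ e_s` gives a cycle in the same space with the
sum of all vectors equal to zero, and perfectness is inherited from it (`Perfect.of_close`).

**The family `𝓕`.** A nonempty `B ∈ φ` contains a singleton `{s}`; collapsing `s` and its neighbours
to one vertex identifies the families containing `{s}` with those of the reduced triple, and `L_B`
with the inverse image of the corresponding space (`IsCollapse`, `IsCircular.pull_span`,
`IsCircular.family_eq`). Uniqueness of `f` follows from (iv) by triangularity
(`Perfect.exists_unique_bijection`).
-/

set_option linter.unusedSectionVars false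

namespace SymplecticTriple

universe u v

/-! ### Arcs of a cyclic permutation -/

/-- `c` is a cyclic permutation of a finite set with an odd number `N ≥ 3` of elements; it
orients the cyclic graph with edges `{t, c t}`. Transitivity is expressed by the absence of
proper nonempty subsets stable under `c`. -/
structure OddCycle {S : Type*} [Fintype S] (c : Equiv.Perm S) : Prop where
  trans : ∀ A : Set S, A.Nonempty → (∀ t ∈ A, c t ∈ A) → A = Set.univ
  odd : Odd (Fintype.card S)
  three_le : 3 ≤ Fintype.card S

/-- `t` and `u` are equal or adjacent in the cyclic graph defined by `c`. -/
def Near {S : Type*} (c : Equiv.Perm S) (t u : S) : Prop := u = t ∨ u = c t ∨ t = c u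

/-- `I` is a nonempty proper arc of the cycle. The encoding is that `I` is left at exactly one
place when the cycle is traversed once. -/
def IsArc {S : Type*} (c : Equiv.Perm S) (I : Finset S) : Prop := ∃! t, t ∈ I ∧ c t ∉ I

/-- No element of `I` is equal or adjacent to an element of `J`. -/
def Apart {S : Type*} (c : Equiv.Perm S) (I J : Finset S) : Prop :=
  ∀ t ∈ I, ∀ u ∈ J, ¬ Near c t u

/-- `J` contains `I` together with all neighbours of `I`. -/
def Inside {S : Type*} (c : Equiv.Perm S) (I J : Finset S) : Prop :=
  ∀ t ∈ I, ∀ u, Near c t u → u ∈ J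

theorem Near.symm {S : Type*} {c : Equiv.Perm S} {t u : S} (h : Near c t u) : Near c u t := by
  unfold Near at *; tauto

theorem Apart.symm {S : Type*} {c : Equiv.Perm S} {I J : Finset S} (h : Apart c I J) : Apart c J I :=
  fun t ht u hu hn => h u hu t ht hn.symm

theorem Inside.subset {S : Type*} {c : Equiv.Perm S} {I J : Finset S} (h : Inside c I J) : I ⊆ J :=
  fun t ht => h t ht t (Or.inl rfl)

namespace OddCycle

variable {S : Type*} [Fintype S] [DecidableEq S] {c : Equiv.Perm S}

theorem eq_univ (hc : OddCycle c) {A : Finset S} (hA : A.Nonempty)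
    (h : ∀ t ∈ A, c t ∈ A) : A = Finset.univ := by
  have := hc.trans A (by simpa using hA) (by simpa using h)
  exact_mod_cast this

theorem apply_ne (hc : OddCycle c) (t : S) : c t ≠ t := by
  intro h
  have h1 := hc.eq_univ (A := {t}) (by simp) (by simp [h])
  have h2 := hc.three_le
  rw [← Finset.card_univ, ← h1] at h2
  simp at h2

theorem apply_apply_ne (hc : OddCycle c) (t : S) : c (c t) ≠ t := by
  intro h
  have h1 := hc.eq_univ (A := {t, c t}) (by simp) (by simp [h])
  have h2 := hc.three_le
  rw [← Finset.card_univ, ← h1] at h2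
  have h3 := Finset.card_le_two (a := t) (b := c t)
  omega

theorem isCycleOn (hc : OddCycle c) : c.IsCycleOn ((Finset.univ : Finset S) : Set S) := by
  refine ⟨by simp [Set.bijOn_univ], fun x _ y _ => ?_⟩
  have := hc.trans {y | c.SameCycle x y} ⟨x, Equiv.Perm.SameCycle.refl _ _⟩
    (fun t ht => ht.apply_right)
  have h2 : y ∈ {y | c.SameCycle x y} := by rw [this]; trivial
  exact h2

theorem exists_pow_eq (hc : OddCycle c) (a b : S) : ∃ n < Fintype.card S, (c ^ n) a = b :=
  hc.isCycleOn.exists_pow_eq (Finset.mem_univ a) (Finset.mem_univ b)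

theorem pow_card (hc : OddCycle c) (a : S) : (c ^ Fintype.card S) a = a :=
  hc.isCycleOn.pow_card_apply (Finset.mem_univ a)

theorem pow_inj (hc : OddCycle c) (a : S) {i j : ℕ} (hi : i < Fintype.card S)
    (hj : j < Fintype.card S) (h : (c ^ i) a = (c ^ j) a) : i = j := by
  have := (hc.isCycleOn.pow_apply_eq_pow_apply (Finset.mem_univ a)).1 h
  exact Nat.ModEq.eq_of_lt_of_lt this hi hj

theorem inv (hc : OddCycle c) : OddCycle c⁻¹ := by
  refine ⟨fun A hA h => ?_, hc.odd, hc.three_le⟩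
  classical
  by_contra hne
  have h1 := hc.trans Aᶜ (by rwa [Set.nonempty_compl]) (fun t ht h2 => ht (by simpa using h _ h2))
  rw [Set.compl_univ_iff] at h1
  exact hA.ne_empty h1

theorem exists_exit (hc : OddCycle c) {A : Finset S} (hA : A.Nonempty) (h : A ≠ Finset.univ) :
    ∃ t, t ∈ A ∧ c t ∉ A := by
  by_contra hcon
  push Not at hcon
  exact h (hc.eq_univ hA hcon)

end OddCycle

section IsArc

variable {S : Type*} {c : Equiv.Perm S} {I J : Finset S}

theorem IsArc.nonempty (h : IsArc c I) : I.Nonempty := h.exists.imp fun _ h => h.1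

theorem IsArc.exit_unique (h : IsArc c I) {t u : S} (ht : t ∈ I) (ht' : c t ∉ I) (hu : u ∈ I)
    (hu' : c u ∉ I) : t = u := h.unique ⟨ht, ht'⟩ ⟨hu, hu'⟩

/-- A finite set is entered as often as it is left, so that arcs can be recognised in either
direction. -/
theorem IsArc.inv (h : IsArc c I) : IsArc c⁻¹ I := by
  classical
  have key : ∀ d : Equiv.Perm S, IsArc d I ↔ (I.filter fun t => d t ∈ I).card + 1 = I.card := by
    intro d
    have h1 := Finset.card_filter_add_card_filter_not (s := I) (fun t => d t ∈ I)
    have h2 : IsArc d I ↔ (I.filter fun t => ¬ d t ∈ I).card = 1 := by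
      rw [Finset.card_eq_one_iff_existsUnique]; simp [IsArc]
    rw [h2]; omega
  rw [key] at h ⊢
  rw [← h]
  congr 1
  refine Finset.card_bij' (fun t _ => c⁻¹ t) (fun t _ => c t) ?_ ?_ ?_ ?_ <;> simp <;> tauto

theorem IsArc.entry_unique (h : IsArc c I) {t u : S} (ht : t ∉ I) (ht' : c t ∈ I) (hu : u ∉ I)
    (hu' : c u ∈ I) : t = u :=
  c.injective (h.inv.exit_unique ht' (by simpa using ht) hu' (by simpa using hu))

theorem IsArc.exists_entry (h : IsArc c I) : ∃ t, t ∉ I ∧ c t ∈ I := by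
  obtain ⟨t, h1, h2⟩ := h.inv.exists
  exact ⟨c⁻¹ t, h2, by simpa using h1⟩

theorem isArc_inv : IsArc c⁻¹ I ↔ IsArc c I := ⟨fun h => by simpa using h.inv, IsArc.inv⟩

theorem Inside.not_inside (hI : IsArc c I) (h : Inside c I J) : ¬ Inside c J I := by
  intro h'
  obtain ⟨t, h1, h2⟩ := hI.exists
  exact h2 (h'.subset (h t h1 _ (Or.inr (Or.inl rfl))))

theorem Inside.ssubset (hI : IsArc c I) (h : Inside c I J) : I ⊂ J := by
  refine ⟨h.subset, fun h' => ?_⟩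
  obtain ⟨t, h1, h2⟩ := hI.exists
  exact h2 (h' (h t h1 _ (Or.inr (Or.inl rfl))))

end IsArc

namespace OddCycle

variable {S : Type*} [Fintype S] [DecidableEq S] {c : Equiv.Perm S} {I J : Finset S}

/-- An arc consists of consecutive points, starting with the point `a` where it is entered. -/
theorem arc_eq (hc : OddCycle c) (h : IsArc c I) : ∃ a, a ∈ I ∧ c⁻¹ a ∉ I ∧
    I.card < Fintype.card S ∧ I = (Finset.range I.card).image fun i => (c ^ i) a := by
  obtain ⟨a, ha, ha'⟩ := h.inv.exists
  have hne : I ≠ Finset.univ := fun h => ha' (by simp [h])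
  have hlt : I.card < Fintype.card S := by
    rw [← Finset.card_univ]; exact Finset.card_lt_card ⟨Finset.subset_univ _, fun h =>
      hne (Finset.univ_subset_iff.1 h)⟩
  have hex : ∃ m, (c ^ m) a ∉ I := by
    obtain ⟨n, -, hn⟩ := hc.exists_pow_eq a (c⁻¹ a)
    exact ⟨n, by rwa [hn]⟩
  set m := Nat.find hex with hm
  have hm1 : (c ^ m) a ∉ I := Nat.find_spec hex
  have hm2 : ∀ i < m, (c ^ i) a ∈ I := fun i hi => by simpa using Nat.find_min hex hi
  have hm0 : m ≠ 0 := fun h0 => hm1 (by rw [h0]; simpa using ha)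
  have hmc : m ≤ Fintype.card S := by
    obtain ⟨n, hn', hn⟩ := hc.exists_pow_eq a (c⁻¹ a)
    exact (Nat.find_min' hex (by rwa [hn])).trans hn'.le
  set K := (Finset.range m).image fun i => (c ^ i) a with hK
  have hKI : K ⊆ I := by
    intro x hx
    obtain ⟨i, hi, rfl⟩ := Finset.mem_image.1 hx
    exact hm2 i (Finset.mem_range.1 hi)
  have hexit : c ((c ^ (m - 1)) a) = (c ^ m) a := by
    rw [← Equiv.Perm.mul_apply, ← pow_succ', Nat.sub_add_cancel (by omega)]
  have hIK : I ⊆ K := by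
    by_contra hcon
    have hA : (I \ K).Nonempty := by rwa [Finset.sdiff_nonempty]
    obtain ⟨t, ht, ht'⟩ := hc.exists_exit hA (fun h => by
      have : c⁻¹ a ∈ I \ K := by simp [h]
      exact ha' (Finset.mem_sdiff.1 this).1)
    rw [Finset.mem_sdiff] at ht ht'
    push Not at ht'
    by_cases hct : c t ∈ I
    · obtain ⟨i, hi, hi'⟩ := Finset.mem_image.1 (ht' hct)
      rcases i with _ | i
      · have : t = c⁻¹ a := by rw [Equiv.Perm.eq_inv_iff_eq]; simpa using hi'.symm
        exact ha' (this ▸ ht.1)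
      · rw [pow_succ', Equiv.Perm.mul_apply] at hi'
        apply ht.2
        rw [← c.injective hi']
        have := Finset.mem_range.1 hi
        exact Finset.mem_image_of_mem _ (Finset.mem_range.2 (by omega))
    · have := h.exit_unique ht.1 hct (hm2 (m - 1) (by omega)) (by rwa [hexit])
      apply ht.2
      rw [this]
      exact Finset.mem_image_of_mem _ (Finset.mem_range.2 (by omega))
  have hIK' : I = K := hIK.antisymm hKI
  have hcard : I.card = m := by
    rw [hIK', hK, Finset.card_image_of_injOn, Finset.card_range]
    intro i hi j hj hij
    simp only [Finset.coe_range, Set.mem_Iio] at hi hj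
    exact hc.pow_inj a (by omega) (by omega) hij
  exact ⟨a, ha, ha', hlt, by rw [hcard]; exact hIK'⟩

theorem isArc_singleton (hc : OddCycle c) (s : S) : IsArc c {s} :=
  ⟨s, by simp [hc.apply_ne], by simp⟩

/-- A segment of fewer than `N` consecutive points is an arc. -/
theorem isArc_image (hc : OddCycle c) (a : S) {m : ℕ} (hm : 0 < m) (hm' : m < Fintype.card S) :
    IsArc c ((Finset.range m).image fun i => (c ^ i) a) := by
  refine ⟨(c ^ (m - 1)) a, ⟨Finset.mem_image_of_mem _ (Finset.mem_range.2 (by omega)), ?_⟩, ?_⟩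
  · rw [← Equiv.Perm.mul_apply, ← pow_succ', Nat.sub_add_cancel (by omega), Finset.mem_image]
    rintro ⟨i, hi, hi'⟩
    have := hc.pow_inj a (by simp at hi; omega) hm' hi'
    simp at hi; omega
  · rintro y ⟨h1, h2⟩
    obtain ⟨i, hi, rfl⟩ := Finset.mem_image.1 h1
    simp only [Finset.mem_range] at hi
    by_cases him : i = m - 1
    · rw [him]
    · exfalso
      apply h2
      rw [← Equiv.Perm.mul_apply, ← pow_succ']
      exact Finset.mem_image_of_mem _ (Finset.mem_range.2 (by omega))

/-- If an arc `J` meets a set `I` without being contained in it, then it contains a point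
outside `I` that is adjacent to `I`. -/
theorem exists_near_mem (hc : OddCycle c) (hJ : IsArc c J) (h1 : (J ∩ I).Nonempty)
    (h2 : ¬ J ⊆ I) : ∃ t ∈ I, ∃ u ∈ J, u ∉ I ∧ Near c t u := by
  by_contra hcon
  push Not at hcon
  have hJu : ∃ x, x ∉ J := by obtain ⟨x, hx, -⟩ := hJ.exists_entry; exact ⟨x, hx⟩
  obtain ⟨x, hx⟩ := hJu
  obtain ⟨t, ht, ht'⟩ := hc.exists_exit h1 (fun h => hx
    (Finset.mem_inter.1 (h ▸ Finset.mem_univ x)).1)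
  obtain ⟨u, hu, hu'⟩ := hc.exists_exit (Finset.sdiff_nonempty.2 h2) (fun h => hx
    (Finset.mem_sdiff.1 (h ▸ Finset.mem_univ x)).1)
  simp only [Finset.mem_inter, Finset.mem_sdiff, not_and, not_not] at ht ht' hu hu'
  have h3 : c t ∉ J := fun h => hcon t ht.2 (c t) h (ht' h) (Or.inr (Or.inl rfl))
  have h4 : c u ∉ J := fun h => hcon (c u) (hu' h) u hu.1 hu.2 (Or.inr (Or.inr rfl))
  have := hJ.exit_unique ht.1 h3 hu.1 h4
  exact hu.2 (this ▸ ht.2)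

/-- A set is determined up to complement by the places where it is entered or left. -/
theorem eq_or_eq_compl (hc : OddCycle c)
    (h : ∀ t, (t ∈ I ↔ c t ∈ I) ↔ (t ∈ J ↔ c t ∈ J)) : I = J ∨ I = Jᶜ := by
  rcases Finset.eq_empty_or_nonempty (Finset.univ.filter fun t => (t ∈ I ↔ t ∈ J)) with h0 | h0
  · right
    ext t
    have : t ∉ Finset.univ.filter fun t => (t ∈ I ↔ t ∈ J) := by rw [h0]; simp
    simp at this ⊢
    tauto
  · left
    have := hc.eq_univ h0 (fun t ht => by
      have := h t
      simp at ht ⊢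
      tauto)
    ext t
    have : t ∈ Finset.univ.filter fun t => (t ∈ I ↔ t ∈ J) := by rw [this]; simp
    simpa using this

end OddCycle

/-! ### Triangular numbers modulo two -/

/-- The class of `½ k (k + 1)` modulo `2`. -/
def tri (k : ℤ) : ZMod 2 := ((k * (k + 1) / 2 : ℤ) : ZMod 2)

theorem tri_add_two_mul (k m : ℤ) : tri (k + 2 * m) = tri k + m := by
  unfold tri
  obtain ⟨j, hj⟩ := Int.even_mul_succ_self k
  have h1 : (k + 2 * m) * (k + 2 * m + 1) = (j + m + 2 * (m * k + m * m)) * 2 := by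
    linear_combination hj
  have h2 : k * (k + 1) = j * 2 := by linear_combination hj
  rw [h1, h2, Int.mul_ediv_cancel _ two_ne_zero, Int.mul_ediv_cancel _ two_ne_zero]
  push_cast
  have : (2 : ZMod 2) = 0 := rfl
  rw [this]; ring

theorem tri_neg_one_sub (k : ℤ) : tri (-1 - k) = tri k := by
  unfold tri; congr 2; ring

theorem tri_natCast (n : ℕ) : tri n = ((n * (n + 1) / 2 : ℕ) : ZMod 2) := by
  unfold tri; norm_cast

/-! ### Height functions -/

/-- `y` is a height function on the cycle: along each edge it changes by exactly one, or it
vanishes at both ends. -/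
def IsHeight {S : Type*} (c : Equiv.Perm S) (y : S → ℤ) : Prop :=
  ∀ t, (y t = 0 ∧ y (c t) = 0) ∨ y (c t) = y t + 1 ∨ y (c t) = y t - 1

section Height

variable {S : Type*} [Fintype S] [DecidableEq S] {c : Equiv.Perm S}

/-- Since `y` and `-1 - y` have opposite parities, selecting at each step the one whose parity is
that of the number of steps turns a height function into a walk with steps `±1`. As the cycle
is odd, the walk comes back reflected. -/
theorem IsHeight.exists_walk (hc : OddCycle c) {y : S → ℤ} (hy : IsHeight c y) (s : S) :
    ∃ k : ℕ → ℤ, (∀ i, k (i + 1) = k i + 1 ∨ k (i + 1) = k i - 1) ∧ (∀ i, (k i - i) % 2 = 0) ∧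
      (∀ i, k i = y ((c ^ i) s) ∨ k i = -1 - y ((c ^ i) s)) ∧
      k (Fintype.card S) = -1 - k 0 := by
  have h3 : ∀ i : ℕ, ∃ k : ℤ, (k = y ((c ^ i) s) ∨ k = -1 - y ((c ^ i) s)) ∧ (k - i) % 2 = 0 := by
    intro i
    by_cases h : (y ((c ^ i) s) - i) % 2 = 0
    · exact ⟨_, Or.inl rfl, h⟩
    · exact ⟨_, Or.inr rfl, by omega⟩
  choose k hk hk' using h3
  refine ⟨k, fun i => ?_, hk', hk, ?_⟩
  · have h1 := hk i
    have h2 := hk (i + 1)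
    have h1' := hk' i
    have h2' := hk' (i + 1)
    push_cast at h2'
    rw [pow_succ', Equiv.Perm.mul_apply] at h2
    rcases hy ((c ^ i) s) with h | h | h <;> omega
  · have h1 := hk 0
    have h2 := hk (Fintype.card S)
    have h1' := hk' 0
    have h2' := hk' (Fintype.card S)
    rw [hc.pow_card] at h2
    obtain ⟨q, hq⟩ := hc.odd
    rw [hq] at h2' ⊢
    rw [hq] at h2
    push_cast at h1' h2'
    simp only [pow_zero, Equiv.Perm.one_apply] at h1
    omega

/-- A height function is determined, up to the pointwise ambiguity between `y` and `-1 - y`, by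
its triangular numbers modulo two, even if these are known only up to a constant. -/
theorem IsHeight.eq_or_eq (hc : OddCycle c) {y z : S → ℤ} (hy : IsHeight c y) (hz : IsHeight c z)
    (a : ZMod 2) (h : ∀ s, tri (z s) = tri (y s) + a) (s : S) : z s = y s ∨ z s = -1 - y s := by
  obtain ⟨k, k1, k2, k3, k4⟩ := hy.exists_walk hc s
  obtain ⟨l, l1, l2, l3, l4⟩ := hz.exists_walk hc s
  have hm : ∀ i, ∃ m, l i = k i + 2 * m := fun i =>
    ⟨(l i - k i) / 2, by have := k2 i; have := l2 i; omega⟩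
  choose m hm using hm
  have hma : ∀ i, (m i : ZMod 2) = a := by
    intro i
    have h1 : tri (k i) = tri (y ((c ^ i) s)) := by
      rcases k3 i with h | h <;> rw [h]
      exact tri_neg_one_sub _
    have h2 : tri (l i) = tri (z ((c ^ i) s)) := by
      rcases l3 i with h | h <;> rw [h]
      exact tri_neg_one_sub _
    rw [h, ← h1, hm, tri_add_two_mul] at h2
    exact add_left_cancel h2
  have hm0 : ∀ i, m i = m 0 := by
    intro i
    induction i with
    | zero => rfl
    | succ i ih =>
      have h1 : ((m (i + 1) : ℤ) : ZMod 2) = (m i : ℤ) := (hma _).trans (hma _).symm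
      have h2 := (ZMod.intCast_eq_intCast_iff' _ _ 2).1 h1
      have := k1 i
      have := l1 i
      have := hm i
      have := hm (i + 1)
      push_cast at h2
      omega
  have h1 := hm0 (Fintype.card S)
  have h2 := hm 0
  have h3 := hm (Fintype.card S)
  have h4 : l 0 = k 0 := by omega
  have h5 := k3 0
  have h6 := l3 0
  simp only [pow_zero, Equiv.Perm.one_apply] at h5 h6
  omega

end Height

/-! ### Laminar families of arcs -/

/-- A family of odd arcs any two of which are equal, apart, or strictly nested. -/
structure IsLaminar {S : Type*} (c : Equiv.Perm S) (B : Finset (Finset S)) : Prop where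
  arc : ∀ I ∈ B, IsArc c I
  odd : ∀ I ∈ B, Odd I.card
  nested : ∀ I ∈ B, ∀ J ∈ B, I = J ∨ Apart c I J ∨ Inside c I J ∨ Inside c J I

/-- A laminar family of odd arcs such that the number of members through a point is a height
function. These turn out to be the elements of `φ(V)`. -/
structure IsAdmissible {S : Type*} [DecidableEq S] (c : Equiv.Perm S) (B : Finset (Finset S)) :
    Prop extends IsLaminar c B where
  height : IsHeight c fun s => (g s B : ℤ)

/-- The number of members of `B` that contain `I`. -/
def depth {S : Type*} [DecidableEq S] (B : Finset (Finset S)) (I : Finset S) : ℕ :=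
  (B.filter fun J => I ⊆ J).card

section Laminar

variable {S : Type*} [DecidableEq S] {c : Equiv.Perm S} {B : Finset (Finset S)}

/-- No two members of a laminar family have an end in common. -/
theorem IsLaminar.eq_of_end (hB : IsLaminar c B) {I J : Finset S} (hI : I ∈ B) (hJ : J ∈ B)
    {t : S} (h1 : ¬ (t ∈ I ↔ c t ∈ I)) (h2 : ¬ (t ∈ J ↔ c t ∈ J)) : I = J := by
  have n1 : Near c t t := Or.inl rfl
  have n2 : Near c t (c t) := Or.inr (Or.inl rfl)
  have n3 : Near c (c t) (c t) := Or.inl rfl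
  have n4 : Near c (c t) t := Or.inr (Or.inr rfl)
  rcases hB.nested I hI J hJ with h | h | h | h
  · exact h
  · have := h t; have := h (c t); grind
  · have := h t; have := h (c t); grind
  · have := h t; have := h (c t); grind

theorem IsLaminar.inside_of_ssubset (hB : IsLaminar c B) {I J : Finset S} (hI : I ∈ B)
    (hJ : J ∈ B) (h : I ⊂ J) : Inside c I J := by
  rcases hB.nested I hI J hJ with h' | h' | h' | h'
  · exact absurd h' h.ne
  · obtain ⟨t, ht⟩ := (hB.arc I hI).nonempty
    exact absurd (Or.inl rfl) (h' t ht t (h.subset ht))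
  · exact h'
  · exact absurd h'.subset h.not_subset

theorem IsLaminar.subset_or_subset (hB : IsLaminar c B) {I J : Finset S} (hI : I ∈ B)
    (hJ : J ∈ B) {s : S} (h1 : s ∈ I) (h2 : s ∈ J) : I ⊆ J ∨ J ⊆ I := by
  rcases hB.nested I hI J hJ with h' | h' | h' | h'
  · exact Or.inl h'.subset
  · exact absurd (Or.inl rfl) (h' s h1 s h2)
  · exact Or.inl h'.subset
  · exact Or.inr h'.subset

/-- The members through `s` form a chain, so their depths are `1, …, g_s(B)`, with sum
`½ g_s(B) (g_s(B) + 1)`. -/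
theorem IsLaminar.sum_depth (hB : IsLaminar c B) (s : S) :
    ∑ I ∈ B with s ∈ I, depth B I = g s B * (g s B + 1) / 2 := by
  have hlt : ∀ I ∈ B, ∀ J, I ⊆ J → I ≠ J → depth B J < depth B I := by
    intro I hI J hsub hne
    refine Finset.card_lt_card ⟨fun K hK => ?_, fun h => ?_⟩
    · simp only [Finset.mem_filter] at hK ⊢
      exact ⟨hK.1, hsub.trans hK.2⟩
    · have := h (Finset.mem_filter.2 ⟨hI, subset_rfl⟩)
      exact hne (hsub.antisymm (Finset.mem_filter.1 this).2)
  have hinj : Set.InjOn (depth B) (B.filter fun I => s ∈ I) := by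
    intro I hI J hJ hIJ
    rw [Finset.mem_coe, Finset.mem_filter] at hI hJ
    by_contra hne
    rcases hB.subset_or_subset hI.1 hJ.1 hI.2 hJ.2 with h | h
    · exact (hlt I hI.1 J h hne).ne' hIJ
    · exact (hlt J hJ.1 I h (Ne.symm hne)).ne hIJ
  have himg : (B.filter fun I => s ∈ I).image (depth B) = (Finset.range (g s B + 1)).erase 0 := by
    apply Finset.eq_of_subset_of_card_le
    · intro d hd
      obtain ⟨I, hI, rfl⟩ := Finset.mem_image.1 hd
      rw [Finset.mem_filter] at hI
      simp only [Finset.mem_erase, Finset.mem_range, Nat.lt_succ_iff]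
      constructor
      · exact Finset.card_ne_zero_of_mem (Finset.mem_filter.2 ⟨hI.1, subset_rfl⟩)
      · exact Finset.card_le_card fun J hJ => by
          rw [Finset.mem_filter] at hJ ⊢
          exact ⟨hJ.1, hJ.2 hI.2⟩
    · rw [Finset.card_image_of_injOn hinj, Finset.card_erase_of_mem (by simp), Finset.card_range]
      simp [g]
  rw [← Finset.sum_image (f := fun d => d) hinj, himg, Finset.sum_erase (a := 0) _ rfl,
    Finset.sum_range_id, Nat.add_sub_cancel, mul_comm]

theorem g_eq_sum (s : S) (B : Finset (Finset S)) : (g s B : ℤ) = ∑ I ∈ B with s ∈ I, 1 := by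
  simp [g]

/-- Across an end of a member `I` of a laminar family, the sum of `w` over the members through a
point changes by `w I`. -/
theorem IsLaminar.sum_sub_sum (hB : IsLaminar c B) (w : Finset S → ℤ) {I : Finset S} {t : S}
    (hI : I ∈ B) (hIt : ¬ (t ∈ I ↔ c t ∈ I)) :
    ∑ J ∈ B with c t ∈ J, w J = ∑ J ∈ B with t ∈ J, w J + w I ∨
      ∑ J ∈ B with c t ∈ J, w J = ∑ J ∈ B with t ∈ J, w J - w I := by
  have key : ∑ J ∈ B with c t ∈ J, w J - ∑ J ∈ B with t ∈ J, w J =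
      (if c t ∈ I then w I else 0) - (if t ∈ I then w I else 0) := by
    rw [Finset.sum_filter, Finset.sum_filter, ← Finset.sum_sub_distrib]
    refine Finset.sum_eq_single_of_mem I hI fun J hJ hne => ?_
    have : t ∈ J ↔ c t ∈ J := by
      by_contra hcon
      exact hne (hB.eq_of_end hJ hI hcon hIt)
    simp [this]
  by_cases h1 : t ∈ I <;> by_cases h2 : c t ∈ I <;> simp [h1, h2] at hIt key <;> omega

/-- Attaching signs to the members of an admissible family gives a signed height function. -/
theorem IsAdmissible.isHeight_sum (hB : IsAdmissible c B) (w : Finset S → ℤ)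
    (hw : ∀ I, w I = 1 ∨ w I = -1) : IsHeight c fun s => ∑ I ∈ B with s ∈ I, w I := by
  intro t
  by_cases h : ∃ I ∈ B, ¬ (t ∈ I ↔ c t ∈ I)
  · obtain ⟨I, hI, hIt⟩ := h
    have h1 := hB.sum_sub_sum w hI hIt
    have h2 := hw I
    dsimp only
    omega
  · push Not at h
    have heq : (B.filter fun I => t ∈ I) = B.filter fun I => c t ∈ I :=
      Finset.filter_congr h
    left
    have hg : g t B = g (c t) B := by unfold g; rw [heq]
    have h0 : g t B = 0 := by
      have := hB.height t
      dsimp only at this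
      omega
    have h1 : (B.filter fun I => t ∈ I) = ∅ := Finset.card_eq_zero.1 h0
    simp [← heq, h1]

/-- A combination `∑ r_I e_I` of the members of an admissible family `B` has, at every point,
the triangular number of a height function bounded by `g(B)` as its coefficient. -/
theorem IsAdmissible.exists_height (hB : IsAdmissible c B) (r : Finset S → ZMod 2) :
    ∃ y : S → ℤ, IsHeight c y ∧ (∀ s, |y s| ≤ g s B) ∧
      ∀ s, tri (y s) = ∑ I ∈ B with s ∈ I, r I := by
  set w : Finset S → ℤ := fun I => if (depth B I : ZMod 2) = r I then 1 else -1 with hw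
  have hw' : ∀ I, w I = 1 ∨ w I = -1 := by intro I; simp only [hw]; split_ifs <;> simp
  refine ⟨_, hB.isHeight_sum w hw', fun s => ?_, fun s => ?_⟩
  · rw [g_eq_sum]
    refine (Finset.abs_sum_le_sum_abs _ _).trans (Finset.sum_le_sum fun I _ => ?_)
    rcases hw' I with h | h <;> simp [h]
  · have h1 : ∀ I, w I = 1 + 2 * (if (depth B I : ZMod 2) = r I then 0 else -1) := by
      intro I; simp only [hw]; split_ifs <;> simp
    rw [Finset.sum_congr rfl fun I _ => h1 I, Finset.sum_add_distrib, ← Finset.mul_sum,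
      ← g_eq_sum, tri_add_two_mul, tri_natCast, ← hB.sum_depth]
    push_cast
    rw [← Finset.sum_add_distrib]
    refine Finset.sum_congr rfl fun I _ => ?_
    generalize (depth B I : ZMod 2) = a
    generalize r I = b
    revert a b; decide

end Laminar

/-! ### Admissible families and their height functions -/

section OfHeight

variable {S : Type*} [Fintype S] [DecidableEq S] {c : Equiv.Perm S}

theorem IsArc.insert_succ (hc : OddCycle c) {K : Finset S} (hK : IsArc c K) {t : S} (ht : t ∈ K)
    (ht' : c t ∉ K) (hne : insert (c t) K ≠ Finset.univ) : IsArc c (insert (c t) K) := by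
  obtain ⟨v, hv, hv'⟩ := hc.exists_exit (Finset.insert_nonempty _ _) hne
  have key : ∀ v, v ∈ insert (c t) K → c v ∉ insert (c t) K → v = c t := by
    intro v hv hv'
    rw [Finset.mem_insert, not_or] at hv'
    refine (Finset.mem_insert.1 hv).resolve_right fun h => hv'.1 ?_
    rw [hK.exit_unique h hv'.2 ht ht']
  exact ⟨v, ⟨hv, hv'⟩, fun w hw => (key w hw.1 hw.2).trans (key v hv hv').symm⟩

/-- Along a stretch on which a height function does not vanish, its parity alternates. -/
theorem IsHeight.parity {y : S → ℤ} (hy : IsHeight c y) (a : S) (m : ℕ)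
    (h : ∀ i ≤ m, y ((c ^ i) a) ≠ 0) : (y ((c ^ m) a) - y a - m) % 2 = 0 := by
  induction m with
  | zero => simp
  | succ m ih =>
    have h1 := ih fun i hi => h i (by omega)
    have h2 := h m (by omega)
    have h3 := hy ((c ^ m) a)
    rw [← Equiv.Perm.mul_apply, ← pow_succ'] at h3
    have h4 := h (m + 1) le_rfl
    rw [Nat.cast_succ]
    omega

/-- A height function on an odd cycle vanishes somewhere, by parity. -/
theorem IsHeight.exists_eq_zero (hc : OddCycle c) {y : S → ℤ} (hy : IsHeight c y) :
    ∃ s, y s = 0 := by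
  by_contra hcon
  push Not at hcon
  have : 0 < Fintype.card S := by have := hc.three_le; omega
  obtain ⟨a⟩ := Fintype.card_pos_iff.1 this
  have h1 := hy.parity a (Fintype.card S) fun i _ => hcon _
  rw [hc.pow_card] at h1
  obtain ⟨q, hq⟩ := hc.odd
  omega

theorem IsHeight.near {y : S → ℤ} (hy : IsHeight c y) {t u : S} (h : Near c t u) :
    y t - y u ≤ 1 ∧ y u - y t ≤ 1 := by
  rcases h with rfl | rfl | rfl
  · simp
  · have := hy t; omega
  · have := hy u; omega

/-- `I` is a component of the set where `h` exceeds `d`. -/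
def IsLevel (c : Equiv.Perm S) (h : S → ℕ) (d : ℕ) (I : Finset S) : Prop :=
  (∀ t ∈ I, d < h t) ∧ ∀ t ∈ I, ∀ u, u ∉ I → Near c t u → h u = d

open Classical in
/-- The family of all arcs of odd cardinality that are components of the superlevel sets
of `h`. -/
noncomputable def ofHeight (c : Equiv.Perm S) (h : S → ℕ) : Finset (Finset S) :=
  Finset.univ.filter fun I => IsArc c I ∧ Odd I.card ∧ ∃ d, IsLevel c h d I

theorem mem_ofHeight {h : S → ℕ} {I : Finset S} :
    I ∈ ofHeight c h ↔ IsArc c I ∧ Odd I.card ∧ ∃ d, IsLevel c h d I := by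
  simp [ofHeight]

/-- Of two different components that meet or touch, the one of lower level contains an outer
neighbour of the other, and then all of its neighbourhood. -/
theorem isLaminar_ofHeight (hc : OddCycle c) (h : S → ℕ) : IsLaminar c (ofHeight c h) := by
  refine ⟨fun I hI => (mem_ofHeight.1 hI).1, fun I hI => (mem_ofHeight.1 hI).2.1, ?_⟩
  have key : ∀ I ∈ ofHeight c h, ∀ J ∈ ofHeight c h, I ≠ J → I ⊆ J → Inside c I J := by
    intro I hI J hJ hne hsub t ht u hu
    obtain ⟨-, -, d, hd1, hd2⟩ := mem_ofHeight.1 hI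
    obtain ⟨hJa, -, e, he1, he2⟩ := mem_ofHeight.1 hJ
    obtain ⟨t', ht', u', hu', hu'', hn⟩ := hc.exists_near_mem (I := I) hJa
      ⟨t, Finset.mem_inter.2 ⟨hsub ht, ht⟩⟩ (fun h => hne (hsub.antisymm h))
    by_contra hu3
    have h1 := hd2 t ht u (fun h => hu3 (hsub h)) hu
    have h2 := he2 t (hsub ht) u hu3 hu
    have h3 := hd2 t' ht' u' hu'' hn
    have h4 := he1 u' hu'
    omega
  intro I hI J hJ
  by_cases hne : I = J
  · exact Or.inl hne
  right
  obtain ⟨hIa, -, d, hd1, hd2⟩ := mem_ofHeight.1 hI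
  obtain ⟨hJa, -, e, he1, he2⟩ := mem_ofHeight.1 hJ
  by_cases hIJ : (I ∩ J).Nonempty
  · right
    by_cases h1 : I ⊆ J
    · exact Or.inl (key I hI J hJ hne h1)
    by_cases h2 : J ⊆ I
    · exact Or.inr (key J hJ I hI (Ne.symm hne) h2)
    exfalso
    obtain ⟨t, ht, u, hu, hu', hn⟩ := hc.exists_near_mem (I := J) hIa hIJ h1
    obtain ⟨t', ht', v, hv, hv', hn'⟩ := hc.exists_near_mem (I := I) hJa
      (by rwa [Finset.inter_comm]) h2
    have := he2 t ht u hu' hn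
    have := hd2 t' ht' v hv' hn'
    have := hd1 u hu
    have := he1 v hv
    omega
  · left
    intro t ht u hu hn
    have h1 : u ∉ I := fun h => hIJ ⟨u, Finset.mem_inter.2 ⟨h, hu⟩⟩
    have h2 : t ∉ J := fun h => hIJ ⟨t, Finset.mem_inter.2 ⟨ht, h⟩⟩
    have := hd2 t ht u h1 hn
    have := he2 u hu t h2 hn.symm
    have := hd1 t ht
    have := he1 u hu
    omega

/-- Every point of height greater than `d` lies in a component of level `d`; the component is
obtained as a largest arc through the point on which `h` exceeds `d`. -/
theorem exists_isLevel (hc : OddCycle c) {h : S → ℕ} (hh : IsHeight c fun s => (h s : ℤ)) {s : S}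
    {d : ℕ} (hd : d < h s) : ∃ I ∈ ofHeight c h, s ∈ I ∧ IsLevel c h d I := by
  classical
  obtain ⟨K, hK, hmax⟩ := (Finset.univ.filter fun K : Finset S =>
    IsArc c K ∧ s ∈ K ∧ ∀ t ∈ K, d < h t).exists_max_image Finset.card
      ⟨{s}, by simp [hc.isArc_singleton, hd]⟩
  simp only [Finset.mem_filter, Finset.mem_univ, true_and] at hK hmax
  obtain ⟨hKa, hsK, hKd⟩ := hK
  obtain ⟨z, hz⟩ := hh.exists_eq_zero hc
  have hins : ∀ u, d < h u → insert u K ≠ Finset.univ := by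
    intro u hu heq
    have : z ∈ insert u K := by rw [heq]; simp
    rcases Finset.mem_insert.1 this with rfl | h1
    · omega
    · have := hKd z h1; omega
  have hout : ∀ t ∈ K, ∀ u, u ∉ K → Near c t u → h u = d := by
    intro t ht u hu hn
    have h1 := hKd t ht
    have h2 := hh.near hn
    by_contra hne
    have h3 : d < h u := by omega
    have h4 : IsArc c (insert u K) := by
      rcases hn with rfl | rfl | h5
      · exact absurd ht hu
      · exact hKa.insert_succ hc ht hu (hins _ h3)
      · have h6 : u = c⁻¹ t := by rw [Equiv.Perm.eq_inv_iff_eq, h5]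
        have := hKa.inv.insert_succ hc.inv ht (by rwa [← h6]) (by rw [← h6]; exact hins u h3)
        rw [← h6] at this
        exact isArc_inv.1 this
    have h5 := hmax _ ⟨h4, Finset.mem_insert_of_mem hsK, fun v hv => by
      rcases Finset.mem_insert.1 hv with rfl | hv
      · exact h3
      · exact hKd v hv⟩
    rw [Finset.card_insert_of_notMem hu] at h5
    omega
  refine ⟨K, mem_ofHeight.2 ⟨hKa, ?_, d, hKd, hout⟩, hsK, hKd, hout⟩
  obtain ⟨a, ha, ha', hcard, hKeq⟩ := hc.arc_eq hKa
  have hmem : ∀ i < K.card, (c ^ i) a ∈ K := fun i hi => by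
    rw [hKeq]; exact Finset.mem_image_of_mem _ (Finset.mem_range.2 hi)
  obtain ⟨t, ht, ht'⟩ := hKa.exists
  obtain ⟨i, hi, hit⟩ : ∃ i < K.card, (c ^ i) a = t := by
    rw [hKeq] at ht
    simpa using ht
  have hi' : i + 1 = K.card := by
    by_contra hne
    apply ht'
    rw [← hit, ← Equiv.Perm.mul_apply, ← pow_succ']
    exact hmem _ (by omega)
  have h1 := hh.parity a i fun j hj => by
    have := hKd _ (hmem j (by omega)); omega
  have n1 : Near c a (c⁻¹ a) := Or.inr (Or.inr (by simp))
  have n2 : Near c t (c t) := Or.inr (Or.inl rfl)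
  have h2 := hout a ha _ ha' n1
  have h3 := hh.near n1
  have h4 := hKd a ha
  have h5 := hout t ht _ ht' n2
  have h6 := hh.near n2
  have h7 := hKd t ht
  rw [hit] at h1
  rw [← hi', Nat.odd_iff]
  omega

/-- There is exactly one component through `s` for each level below `h s`. -/
theorem g_ofHeight (hc : OddCycle c) {h : S → ℕ} (hh : IsHeight c fun s => (h s : ℤ)) (s : S) :
    g s (ofHeight c h) = h s := by
  have hex : ∀ d ∈ Finset.range (h s), ∃ I ∈ ofHeight c h, s ∈ I ∧ IsLevel c h d I :=
    fun d hd => exists_isLevel hc hh (Finset.mem_range.1 hd)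
  choose f hf1 hf2 hf3 using hex
  have key : ∀ I ∈ ofHeight c h, ∀ J d, IsLevel c h d I → IsLevel c h d J → ¬ Inside c I J := by
    intro I hI J d h1 h2 hin
    obtain ⟨t, ht, ht'⟩ := (mem_ofHeight.1 hI).1.exists
    have n : Near c t (c t) := Or.inr (Or.inl rfl)
    have := h1.2 t ht _ ht' n
    have := h2.1 _ (hin t ht _ n)
    omega
  rw [← Finset.card_range (h s)]
  refine (Finset.card_bij f (fun d hd => Finset.mem_filter.2 ⟨hf1 d hd, hf2 d hd⟩) ?_ ?_).symm
  · intro d hd e he hde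
    obtain ⟨t, ht, ht'⟩ := (mem_ofHeight.1 (hf1 d hd)).1.exists
    have n : Near c t (c t) := Or.inr (Or.inl rfl)
    have h1 := (hf3 d hd).2 t ht _ ht' n
    have h2 := (hf3 e he).2 t (hde ▸ ht) _ (hde ▸ ht') n
    omega
  · intro I hI
    rw [Finset.mem_filter] at hI
    obtain ⟨-, -, d, hd⟩ := mem_ofHeight.1 hI.1
    have hd' : d ∈ Finset.range (h s) := Finset.mem_range.2 (hd.1 s hI.2)
    refine ⟨d, hd', ?_⟩
    rcases (isLaminar_ofHeight hc h).nested _ (hf1 d hd') I hI.1 with h1 | h1 | h1 | h1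
    · exact h1
    · exact absurd (Or.inl rfl) (h1 s (hf2 d hd') s hI.2)
    · exact absurd h1 (key _ (hf1 d hd') I d (hf3 d hd') hd)
    · exact absurd h1 (key I hI.1 _ d hd (hf3 d hd'))

theorem isAdmissible_ofHeight (hc : OddCycle c) {h : S → ℕ} (hh : IsHeight c fun s => (h s : ℤ)) :
    IsAdmissible c (ofHeight c h) :=
  ⟨isLaminar_ofHeight hc h, by simpa only [g_ofHeight hc hh] using hh⟩

/-- The members of a laminar family are components of the superlevel sets of the number of
members through a point. -/
theorem IsLaminar.isLevel {B : Finset (Finset S)} (hB : IsLaminar c B) {I : Finset S}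
    (hI : I ∈ B) : ∃ d, IsLevel c (fun s => g s B) d I := by
  classical
  refine ⟨(B.filter fun J => Inside c I J).card, fun t ht => ?_, fun t ht u hu hn => ?_⟩
  · refine Finset.card_lt_card ⟨fun J hJ => ?_, fun h => ?_⟩
    · rw [Finset.mem_filter] at hJ ⊢
      exact ⟨hJ.1, hJ.2.subset ht⟩
    · have := (Finset.mem_filter.1 (h (Finset.mem_filter.2 ⟨hI, ht⟩))).2
      exact this.not_inside (hB.arc I hI) this
  · refine congrArg Finset.card ?_
    refine Finset.filter_congr fun J hJ => ⟨fun huJ => ?_, fun h => h t ht u hn⟩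
    rcases hB.nested I hI J hJ with rfl | h | h | h
    · exact absurd huJ hu
    · exact absurd hn (h t ht u huJ)
    · exact h
    · exact absurd (h.subset huJ) hu

/-- An admissible family is recovered from its height function. -/
theorem IsAdmissible.ofHeight_g (hc : OddCycle c) {B : Finset (Finset S)} (hB : IsAdmissible c B) :
    ofHeight c (fun s => g s B) = B := by
  have hsub : B ⊆ ofHeight c fun s => g s B := fun I hI =>
    mem_ofHeight.2 ⟨hB.arc I hI, hB.odd I hI, hB.isLevel hI⟩
  refine (Finset.Subset.antisymm hsub fun I hI => ?_).symm
  obtain ⟨hIa, -, d, hd⟩ := mem_ofHeight.1 hI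
  obtain ⟨t, ht, ht'⟩ := hIa.exists
  have hlt : g (c t) B < g t B := by
    have h1 : g (c t) B = d := hd.2 t ht _ ht' (Or.inr (Or.inl rfl))
    rw [h1]; exact hd.1 t ht
  have : ∃ J ∈ B, t ∈ J ∧ c t ∉ J := by
    by_contra hcon
    push Not at hcon
    refine hlt.not_ge (Finset.card_le_card fun J hJ => ?_)
    rw [Finset.mem_filter] at hJ ⊢
    exact ⟨hJ.1, hcon J hJ.1 hJ.2⟩
  obtain ⟨J, hJ, htJ, htJ'⟩ := this
  have := (isLaminar_ofHeight hc _).eq_of_end hI (hsub hJ) (t := t) (by simp [ht, ht'])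
    (by simp [htJ, htJ'])
  rwa [this]

theorem IsAdmissible.eq_of_g_eq (hc : OddCycle c) {B B' : Finset (Finset S)}
    (hB : IsAdmissible c B) (hB' : IsAdmissible c B') (h : ∀ s, g s B = g s B') : B = B' := by
  rw [← hB.ofHeight_g hc, ← hB'.ofHeight_g hc]
  congr 1
  exact funext h

/-- Every function with values modulo two is, up to a constant, given by the triangular numbers
of a nonnegative height function. A walk with these triangular numbers comes back reflected
after one turn; measuring heights from its centre of symmetry makes it descend to the cycle. -/
theorem exists_isHeight (hc : OddCycle c) (a : S → ZMod 2) :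
    ∃ h : S → ℕ, IsHeight c (fun s => (h s : ℤ)) ∧ ∃ b, ∀ s, tri (h s) = a s + b := by
  have hpos : 0 < Fintype.card S := by have := hc.three_le; omega
  obtain ⟨s₀⟩ := Fintype.card_pos_iff.1 hpos
  have two : ∀ x y z : ZMod 2, x = y + 1 → x ≠ z → y = z := by decide
  have hshift : ∀ k, tri (k + 1) = tri (k - 1) + 1 := fun k => by
    have := tri_add_two_mul (k - 1) 1
    rwa [show k - 1 + 2 * 1 = k + 1 by ring, Int.cast_one] at this
  -- at each step exactly one of the two directions gives the prescribed triangular number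
  obtain ⟨k, k0, kstep, ktri⟩ : ∃ k : ℕ → ℤ, k 0 = 0 ∧
      (∀ i, k (i + 1) = k i + 1 ∨ k (i + 1) = k i - 1) ∧
      ∀ i, tri (k i) = a ((c ^ i) s₀) + a s₀ := by
    let step : ℕ → ℤ → ℤ := fun i k =>
      if tri (k + 1) = a ((c ^ (i + 1)) s₀) + a s₀ then k + 1 else k - 1
    refine ⟨fun i => Nat.rec 0 step i, rfl, fun i => ?_, fun i => ?_⟩
    · change step i _ = _ ∨ step i _ = _
      simp only [step]
      split_ifs <;> simp
    · cases i with
      | zero => simp [CharTwo.add_self_eq_zero, tri]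
      | succ i =>
        change tri (step i _) = _
        simp only [step]
        split_ifs with h
        · exact h
        · exact two _ _ _ (hshift _) h
  have kpar : ∀ i, (k i - i) % 2 = 0 := by
    intro i
    induction i with
    | zero => simp [k0]
    | succ i ih => have := kstep i; push_cast; omega
  set N := Fintype.card S with hN
  obtain ⟨q, hq⟩ := hc.odd
  obtain ⟨m, hm⟩ : ∃ m, k N = 1 + 2 * m := ⟨(k N - 1) / 2, by have := kpar N; omega⟩
  obtain ⟨r, hr⟩ : ∃ r, m = 2 * r + 1 := by
    have h1 := ktri N
    rw [hc.pow_card, CharTwo.add_self_eq_zero, hm, tri_add_two_mul] at h1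
    have h2 : ((m + 1 : ℤ) : ZMod 2) = (0 : ℤ) := by
      push_cast; rw [add_comm]; exact h1
    have h3 := (ZMod.intCast_eq_intCast_iff' _ _ 2).1 h2
    exact ⟨m / 2, by push_cast at h3; omega⟩
  have htwo : ((2 : ℤ) : ZMod 2) = 0 := rfl
  have krefl : ∀ i, k (i + N) = 4 * r + 3 - k i := by
    intro i
    induction i with
    | zero => rw [k0, zero_add, hm, hr]; ring
    | succ i ih =>
      have h1 := kstep i
      have h2 := kstep (i + N)
      have h3 : tri (k (i + N + 1)) = tri (k (i + 1)) := by
        rw [ktri, ktri, show i + N + 1 = i + 1 + N by ring, pow_add _ (i + 1) N,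
          Equiv.Perm.mul_apply, hc.pow_card]
      have h4 : tri (4 * r + 3 - k (i + 1)) = tri (k (i + 1)) := by
        rw [← tri_neg_one_sub (k (i + 1)), show 4 * r + 3 - k (i + 1) =
          (-1 - k (i + 1)) + 2 * (2 * (r + 1)) by ring, tri_add_two_mul, Int.cast_mul, htwo]
        simp
      rw [show i + 1 + N = i + N + 1 by ring]
      have h5 := hshift (k (i + N))
      have h6 : ∀ x : ZMod 2, x ≠ x + 1 := by decide
      by_contra hne
      have h7 : (k (i + N + 1) = k (i + N) + 1 ∧ 4 * r + 3 - k (i + 1) = k (i + N) - 1) ∨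
        (k (i + N + 1) = k (i + N) - 1 ∧ 4 * r + 3 - k (i + 1) = k (i + N) + 1) := by omega
      rcases h7 with ⟨h8, h9⟩ | ⟨h8, h9⟩
      · rw [h9, ← h3, h8, h5] at h4; exact h6 _ h4
      · rw [h9, ← h3, h8, h5] at h4; exact h6 _ h4.symm
  -- `2 r + 3 / 2` is the centre of symmetry of the walk
  obtain ⟨H, hH⟩ : ∃ H : ℕ → ℕ, ∀ i, (H i : ℤ) = max (k i - (2 * r + 2)) (2 * r + 1 - k i) :=
    ⟨fun i => (max (k i - (2 * r + 2)) (2 * r + 1 - k i)).toNat, fun i => by dsimp only; omega⟩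
  have hHper : Function.Periodic H N := by
    intro i
    have h1 := hH i
    have h2 := hH (i + N)
    rw [krefl] at h2
    omega
  have hHtri : ∀ i, tri (H i) = a ((c ^ i) s₀) + (a s₀ + (r + 1 : ℤ)) := by
    intro i
    have h1 : tri (k i - (2 * r + 2)) = a ((c ^ i) s₀) + (a s₀ + (r + 1 : ℤ)) := by
      have h2 := tri_add_two_mul (k i - (2 * r + 2)) (r + 1)
      rw [show k i - (2 * r + 2) + 2 * (r + 1) = k i by ring, ktri] at h2
      rw [← add_assoc, h2, add_assoc, CharTwo.add_self_eq_zero, add_zero]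
    rw [hH]
    rcases max_choice (k i - (2 * r + 2)) (2 * r + 1 - k i) with h | h <;> rw [h]
    · exact h1
    · rw [← h1, ← tri_neg_one_sub]
      congr 1
      ring
  choose ι hι hι' using fun s => hc.exists_pow_eq s₀ s
  have hHι : ∀ i, H (ι ((c ^ i) s₀)) = H i := by
    intro i
    have h1 := (hc.isCycleOn.pow_apply_eq_pow_apply (Finset.mem_univ s₀)).1 (hι' ((c ^ i) s₀))
    rw [← hHper.map_mod_nat, ← hHper.map_mod_nat i]
    exact congrArg H h1
  refine ⟨fun s => H (ι s), fun t => ?_, a s₀ + (r + 1 : ℤ), fun s => ?_⟩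
  · obtain ⟨i, -, rfl⟩ := hc.exists_pow_eq s₀ t
    rw [← Equiv.Perm.mul_apply, ← pow_succ']
    dsimp only
    rw [hHι, hHι]
    have h1 := kstep i
    have h2 := hH i
    have h3 := hH (i + 1)
    omega
  · have := hHtri (ι s)
    rwa [hι'] at this

end OfHeight

/-! ### Comparison with the graph-theoretic notions -/

/-- The graph of the triple is the cyclic graph oriented by `c`. -/
structure IsCircular {S V : Type*} [Fintype S] [AddCommGroup V] [Module (ZMod 2) V]
    (D : SymplecticTriple S V) (c : Equiv.Perm S) : Prop extends OddCycle c where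
  adj : ∀ s t, D.graph.Adj s t ↔ t = c s ∨ s = c t

namespace IsCircular

variable {S V : Type*} [Fintype S] [DecidableEq S] [AddCommGroup V] [Module (ZMod 2) V]
  {D : SymplecticTriple S V} {c : Equiv.Perm S} {I J : Finset S} {B : Finset (Finset S)}

/-- A connected set is left at most once, since otherwise its graph would have fewer edges than a
spanning tree. -/
theorem exit_unique (hD : D.IsCircular c) {A : Finset S}
    (hA : (D.graph.induce (A : Set S)).Connected) {t u : S} (ht : t ∈ A) (ht' : c t ∉ A)
    (hu : u ∈ A) (hu' : c u ∉ A) : t = u := by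
  by_contra hne
  have h1 := hA.card_vert_le_card_edgeSet_add_one
  let f : {t // t ∈ A.filter fun t => c t ∈ A} → (D.graph.induce (A : Set S)).edgeSet := fun t =>
    ⟨s(⟨t.1, by simpa using (Finset.mem_filter.1 t.2).1⟩,
      ⟨c t.1, by simpa using (Finset.mem_filter.1 t.2).2⟩), by
      simp [hD.adj]⟩
  have hf : Function.Surjective f := by
    rintro ⟨e, he⟩
    induction e using Sym2.ind with
    | _ x y =>
      obtain ⟨x, hx⟩ := x
      obtain ⟨y, hy⟩ := y
      have hxy : y = c x ∨ x = c y := by simpa [hD.adj] using he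
      rcases hxy with rfl | rfl
      · exact ⟨⟨x, Finset.mem_filter.2 ⟨by simpa using hx, by simpa using hy⟩⟩, rfl⟩
      · refine ⟨⟨y, Finset.mem_filter.2 ⟨by simpa using hy, by simpa using hx⟩⟩, ?_⟩
        exact Subtype.ext Sym2.eq_swap
  have h2 := Nat.card_le_card_of_surjective f hf
  have h3 : (A.filter fun t => c t ∈ A) ⊆ (A.erase t).erase u := by
    intro x hx
    rw [Finset.mem_filter] at hx
    rw [Finset.mem_erase, Finset.mem_erase]
    exact ⟨fun h => hu' (h ▸ hx.2), fun h => ht' (h ▸ hx.2), hx.1⟩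
  have h4 := Finset.card_le_card h3
  rw [Finset.card_erase_of_mem (Finset.mem_erase.2 ⟨Ne.symm hne, hu⟩),
    Finset.card_erase_of_mem ht] at h4
  have h5 : 2 ≤ A.card := by
    have := Finset.one_lt_card.2 ⟨t, ht, u, hu, hne⟩
    omega
  simp only [Nat.card_eq_fintype_card, Fintype.card_coe] at h2
  have h6 : Nat.card (A : Set S) = A.card := by simp
  omega

theorem isTypeA_of_isArc (hD : D.IsCircular c) (hI : IsArc c I) : D.IsTypeA I := by
  obtain ⟨a, ha, -, hlt, heq⟩ := hD.arc_eq hI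
  have hmem : ∀ i < I.card, (c ^ i) a ∈ I := fun i hi => by
    rw [heq]; exact Finset.mem_image_of_mem _ (Finset.mem_range.2 hi)
  refine ⟨I.card, Finset.card_pos.2 ⟨a, ha⟩, ⟨RelIso.symm ⟨Equiv.ofBijective
    (fun i : Fin I.card => (⟨(c ^ i.1) a, by simpa using hmem i i.2⟩ : (I : Set S)))
    ⟨fun i j hij => ?_, ?_⟩, ?_⟩⟩⟩
  · exact Fin.ext (hD.pow_inj a (i.2.trans hlt) (j.2.trans hlt) (congrArg Subtype.val hij))
  · rintro ⟨x, hx⟩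
    have hx' : x ∈ I := by simpa using hx
    rw [heq] at hx'
    obtain ⟨i, hi, rfl⟩ := Finset.mem_image.1 hx'
    exact ⟨⟨i, Finset.mem_range.1 hi⟩, rfl⟩
  · intro i j
    have key : ∀ i j : Fin I.card, (c ^ j.1) a = c ((c ^ i.1) a) ↔ i.1 + 1 = j.1 := by
      intro i j
      rw [← Equiv.Perm.mul_apply, ← pow_succ']
      refine ⟨fun h => (hD.pow_inj a (by omega) (by omega) h).symm, fun h => by rw [h]⟩
    rw [SimpleGraph.comap_adj, hD.adj, SimpleGraph.pathGraph_adj, ← key, ← key]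
    exact Iff.rfl

theorem connected_of_isArc (hD : D.IsCircular c) (hI : IsArc c I) :
    (D.graph.induce (I : Set S)).Connected := by
  obtain ⟨m, hm, ⟨φ⟩⟩ := hD.isTypeA_of_isArc hI
  obtain ⟨m, rfl⟩ := Nat.exists_eq_add_of_le' hm
  exact φ.connected_iff.2 (SimpleGraph.pathGraph_connected m)

theorem isTypeA_iff (hD : D.IsCircular c) : D.IsTypeA I ↔ IsArc c I := by
  refine ⟨fun h => ?_, hD.isTypeA_of_isArc⟩
  obtain ⟨m, hm, ⟨φ⟩⟩ := h
  obtain ⟨m, rfl⟩ := Nat.exists_eq_add_of_le' hm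
  have hconn : (D.graph.induce (I : Set S)).Connected :=
    φ.connected_iff.2 (SimpleGraph.pathGraph_connected m)
  have hex : ∃ t, t ∈ I ∧ c t ∉ I := by
    obtain ⟨x⟩ := hconn.nonempty
    refine hD.exists_exit ⟨x.1, by simp⟩ fun huniv => ?_
    -- the end of the path has one neighbour only, whereas each vertex of the cycle has two
    have hall : ∀ s, s ∈ (I : Set S) := fun s => by simp [huniv]
    set v := φ.symm 0 with hv
    have h1 : ∀ u, D.graph.Adj v.1 u → (φ ⟨u, hall u⟩).1 = 1 := by
      intro u hu
      have h2 : (D.graph.induce (I : Set S)).Adj v ⟨u, hall u⟩ := hu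
      have h3 := φ.map_adj_iff.2 h2
      rw [hv, RelIso.apply_symm_apply, SimpleGraph.pathGraph_adj] at h3
      simpa [eq_comm] using h3
    have h2 := h1 (c v.1) ((hD.adj _ _).2 (Or.inl rfl))
    have h3 := h1 (c⁻¹ v.1) ((hD.adj _ _).2 (Or.inr (by simp)))
    have h4 := φ.injective (Fin.ext (h2.trans h3.symm))
    have h5 : c v.1 = c⁻¹ v.1 := congrArg Subtype.val h4
    rw [Equiv.Perm.eq_inv_iff_eq] at h5
    exact hD.apply_apply_ne _ h5
  obtain ⟨t, ht⟩ := hex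
  exact ⟨t, ht, fun u hu => hD.exit_unique hconn hu.1 hu.2 ht.1 ht.2⟩

theorem mem_oddIntervals (hD : D.IsCircular c) :
    I ∈ D.oddIntervals ↔ IsArc c I ∧ Odd I.card := by
  unfold oddIntervals; rw [Set.mem_ofPred_eq, hD.isTypeA_iff]

/-- Two arcs side by side form an arc, unless they fill the cycle; this is impossible for two arcs
of odd cardinality. -/
theorem isArc_union (hD : D.IsCircular c) (hI : IsArc c I) (hJ : IsArc c J) (hIo : Odd I.card)
    (hJo : Odd J.card) (hdis : Disjoint I J) {t : S} (ht : t ∈ I) (ht' : c t ∈ J) :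
    IsArc c (I ∪ J) := by
  have htI : c t ∉ I := fun h => Finset.disjoint_left.1 hdis h ht'
  have key : ∀ v, v ∈ I ∪ J → c v ∉ I ∪ J → v ∈ J ∧ c v ∉ J := by
    intro v hv hv'
    rw [Finset.mem_union, not_or] at hv'
    refine ⟨(Finset.mem_union.1 hv).resolve_left fun h => hv'.2 ?_, hv'.2⟩
    rwa [hI.exit_unique h hv'.1 ht htI]
  obtain ⟨v, hv, hv'⟩ := hD.exists_exit (A := I ∪ J) ⟨t, Finset.mem_union_left _ ht⟩ fun h => by
    have h1 := Finset.card_union_of_disjoint hdis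
    rw [h, Finset.card_univ] at h1
    have := hD.odd
    rw [h1, Nat.odd_add] at this
    exact Nat.not_even_iff_odd.2 hJo (this.1 hIo)
  exact ⟨v, ⟨hv, hv'⟩, fun w hw =>
    hJ.unique (key w hw.1 hw.2) (key v hv hv')⟩

/-- If `I` and `J` are apart, then `I ∪ J` is left both at the end of `I` and at that of `J`; if they
touch, then `I ∪ J` is an arc. -/
theorem spade_iff (hD : D.IsCircular c) (hI : I ∈ D.oddIntervals) (hJ : J ∈ D.oddIntervals) :
    D.Spade I J ↔ Apart c I J := by
  rw [hD.mem_oddIntervals] at hI hJ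
  unfold Spade Disconnected
  rw [← Finset.coe_union]
  constructor
  · rintro ⟨hdis, hdc⟩ t ht u hu (rfl | rfl | rfl)
    · exact Finset.disjoint_left.1 hdis ht hu
    · exact hdc (hD.connected_of_isArc (hD.isArc_union hI.1 hJ.1 hI.2 hJ.2 hdis ht hu))
    · rw [Finset.union_comm] at hdc
      exact hdc (hD.connected_of_isArc (hD.isArc_union hJ.1 hI.1 hJ.2 hI.2 hdis.symm hu ht))
  · intro h
    have hdis : Disjoint I J := Finset.disjoint_left.2 fun t h1 h2 => h t h1 t h2 (Or.inl rfl)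
    refine ⟨hdis, fun hcon => ?_⟩
    obtain ⟨t, ht, ht'⟩ := hI.1.exists
    obtain ⟨u, hu, hu'⟩ := hJ.1.exists
    have h1 : c t ∉ J := fun h1 => h t ht _ h1 (Or.inr (Or.inl rfl))
    have h2 : c u ∉ I := fun h2 => h _ h2 u hu (Or.inr (Or.inr rfl))
    have := hD.exit_unique hcon (t := t) (u := u) (by simp [ht]) (by simp [ht', h1])
      (by simp [hu]) (by simp [hu', h2])
    exact Finset.disjoint_left.1 hdis ht (this ▸ hu)

/-- If `J` contains `I` together with its neighbours, then `J \ I` is left twice, namely before `I`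
and at the end of `J`; if `J` misses a neighbour of `I`, then `J \ I` is an arc. -/
theorem prec_iff (hD : D.IsCircular c) (hI : I ∈ D.oddIntervals) (hJ : J ∈ D.oddIntervals) :
    D.Prec I J ↔ Inside c I J := by
  rw [hD.mem_oddIntervals] at hI hJ
  unfold Prec Disconnected
  rw [← Finset.coe_sdiff]
  obtain ⟨t, ht, ht'⟩ := hI.1.exists
  obtain ⟨u, hu, hu'⟩ := hI.1.exists_entry
  obtain ⟨v, hv, hv'⟩ := hJ.1.exists
  constructor
  · rintro ⟨hsub, hdc⟩
    have hne : (J \ I).Nonempty := Finset.sdiff_nonempty.2 hsub.not_subset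
    have hsub := hsub.subset
    obtain ⟨w, hw, hw'⟩ := hD.exists_exit hne fun h => hv' (Finset.mem_sdiff.1
      (h.symm ▸ Finset.mem_univ (c v))).1
    -- a set `J \ I` with a single exit would be an arc, hence connected
    have key : ∀ x, (∀ y, y ∈ J \ I → c y ∉ J \ I → y = x) → False := fun x hx =>
      hdc (hD.connected_of_isArc ⟨w, ⟨hw, hw'⟩, fun y hy =>
        (hx y hy.1 hy.2).trans (hx w hw hw').symm⟩)
    have hct : c t ∈ J := by
      by_contra hct
      refine key u fun y hy hy' => ?_
      simp only [Finset.mem_sdiff, not_and, not_not] at hy hy'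
      by_cases hcy : c y ∈ J
      · exact hI.1.entry_unique hy.2 (hy' hcy) hu hu'
      · exact absurd (hJ.1.exit_unique hy.1 hcy (hsub ht) hct ▸ ht) hy.2
    have huJ : u ∈ J := by
      by_contra huJ
      refine key v fun y hy hy' => ?_
      simp only [Finset.mem_sdiff, not_and, not_not] at hy hy'
      by_cases hcy : c y ∈ J
      · exact absurd (hI.1.entry_unique hy.2 (hy' hcy) hu hu' ▸ hy.1) huJ
      · exact hJ.1.exit_unique hy.1 hcy hv hv'
    rintro x hx y (rfl | rfl | rfl)
    · exact hsub hx
    · by_cases h : c x ∈ I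
      · exact hsub h
      · rwa [hI.1.exit_unique hx h ht ht']
    · by_cases h : y ∈ I
      · exact hsub h
      · rwa [hI.1.entry_unique h hx hu hu']
  · intro h
    refine ⟨h.ssubset hI.1, fun hcon => ?_⟩
    have h1 : u ∈ J := h _ hu' u (Or.inr (Or.inr rfl))
    have h2 : v ∉ I := fun h2 => hv' (h v h2 _ (Or.inr (Or.inl rfl)))
    have := hD.exit_unique hcon (t := u) (u := v) (by simp [h1, hu]) (by simp [hu'])
      (by simp [hv, h2]) (by simp [hv'])
    rw [this] at hu'
    exact hv' (h.subset hu')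

/-- In an arc `a, c a, …, c ^ (m - 1) a` with `m` odd, the points of `I^{ev}` are those in odd
position, counted from `0`. -/
theorem pow_mem_evenPart (hD : D.IsCircular c) {a : S} (hlt : I.card < Fintype.card S)
    (heq : I = (Finset.range I.card).image fun i => (c ^ i) a) (ho : Odd I.card) {j : ℕ}
    (hj : Odd j) (hjm : j + 1 < I.card) : (c ^ j) a ∈ D.evenPart I := by
  have hinj : ∀ {i k : ℕ}, i < I.card → k < I.card → (c ^ i) a = (c ^ k) a → i = k :=
    fun hi hk h => hD.pow_inj a (hi.trans hlt) (hk.trans hlt) h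
  set I' := (Finset.range j).image fun i => (c ^ i) a with hI'
  set I'' := (Finset.range (I.card - (j + 1))).image fun i => (c ^ i) ((c ^ (j + 1)) a) with hI''
  have mem' : ∀ {x}, x ∈ I' ↔ ∃ i < j, (c ^ i) a = x := by simp [hI']
  have mem'' : ∀ {x}, x ∈ I'' ↔ ∃ i, j + 1 ≤ i ∧ i < I.card ∧ (c ^ i) a = x := by
    intro x
    simp only [hI'', Finset.mem_image, Finset.mem_range]
    constructor
    · rintro ⟨i, hi, rfl⟩
      exact ⟨i + (j + 1), by omega, by omega, by rw [pow_add, Equiv.Perm.mul_apply]⟩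
    · rintro ⟨i, hi, hi', rfl⟩
      refine ⟨i - (j + 1), by omega, ?_⟩
      rw [← Equiv.Perm.mul_apply, ← pow_add, Nat.sub_add_cancel hi]
  have mem : ∀ {x}, x ∈ I ↔ ∃ i < I.card, (c ^ i) a = x := by
    intro x
    nth_rw 1 [heq]
    simp
  have hodd : Odd (I.card - (j + 1)) := by
    rw [Nat.odd_iff] at *; omega
  have hIo' : I' ∈ D.oddIntervals := by
    refine hD.mem_oddIntervals.2 ⟨hD.isArc_image a hj.pos (by omega), ?_⟩
    rw [hI', Finset.card_image_of_injOn, Finset.card_range]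
    · exact hj
    · intro x hx y hy hxy
      simp only [Finset.coe_range, Set.mem_Iio] at hx hy
      exact hinj (by omega) (by omega) hxy
  have hIo'' : I'' ∈ D.oddIntervals := by
    refine hD.mem_oddIntervals.2 ⟨hD.isArc_image _ hodd.pos (by omega), ?_⟩
    rw [hI'', Finset.card_image_of_injOn, Finset.card_range]
    · exact hodd
    · intro x hx y hy hxy
      simp only [Finset.coe_range, Set.mem_Iio] at hx hy
      exact hD.pow_inj _ (by omega) (by omega) hxy
  refine ⟨mem.2 ⟨j, by omega, rfl⟩, I', hIo', I'', hIo'', (hD.spade_iff hIo' hIo'').2 ?_, ?_⟩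
  · intro x hx y hy hn
    obtain ⟨i, hi, rfl⟩ := mem'.1 hx
    obtain ⟨k, hk, hk', rfl⟩ := mem''.1 hy
    rcases hn with h | h | h
    · have := hinj (by omega) (by omega) h; omega
    · rw [← Equiv.Perm.mul_apply, ← pow_succ'] at h
      have := hinj (by omega) (by omega) h; omega
    · rw [← Equiv.Perm.mul_apply, ← pow_succ'] at h
      have := hD.pow_inj a (by omega) (by omega) h; omega
  · ext x
    simp only [Set.mem_sdiff, Finset.mem_coe, Set.mem_singleton_iff, Set.mem_union, mem', mem'', mem]
    constructor
    · rintro ⟨⟨i, hi, rfl⟩, hne⟩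
      have : i ≠ j := fun h => hne (by rw [h])
      rcases lt_or_gt_of_ne this with h | h
      · exact Or.inl ⟨i, h, rfl⟩
      · exact Or.inr ⟨i, h, hi, rfl⟩
    · rintro (⟨i, hi, rfl⟩ | ⟨i, hi, hi', rfl⟩)
      · exact ⟨⟨i, by omega, rfl⟩, fun h => by have := hinj (by omega) (by omega) h; omega⟩
      · exact ⟨⟨i, by omega, rfl⟩, fun h => by have := hinj (by omega) (by omega) h; omega⟩

/-- Removing a point of `I^{ev}` leaves two arcs, the first of which consists of the points
preceding it. -/
theorem odd_of_pow_mem_evenPart (hD : D.IsCircular c) {a : S} (hlt : I.card < Fintype.card S)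
    (heq : I = (Finset.range I.card).image fun i => (c ^ i) a) {j : ℕ} (hjm : j < I.card)
    (hj : (c ^ j) a ∈ D.evenPart I) : Odd j := by
  obtain ⟨-, I', hI', I'', hI'', hsp, hun⟩ := hj
  rw [hD.spade_iff hI' hI''] at hsp
  wlog hwl : j = 0 ∨ a ∈ I' generalizing I' I''
  · refine this I'' hI'' I' hI' hsp.symm (by rwa [Set.union_comm]) ?_
    right
    have h1 : a ∈ (I : Set S) \ {(c ^ j) a} := by
      refine ⟨?_, fun h => hwl (Or.inl ?_)⟩
      · rw [heq]; simp; exact ⟨0, by omega, by simp⟩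
      · exact hD.pow_inj a (by omega) (by omega) (h.symm.trans (by simp))
    rw [hun] at h1
    exact h1.resolve_left fun h => hwl (Or.inr h)
  have hmem : ∀ x, x ∈ I' ∨ x ∈ I'' ↔ ∃ i < I.card, i ≠ j ∧ (c ^ i) a = x := by
    intro x
    have h1 : (x ∈ (I : Set S) \ {(c ^ j) a}) ↔ x ∈ I' ∨ x ∈ I'' := by rw [hun]; simp
    have h2 : x ∈ I ↔ ∃ i < I.card, (c ^ i) a = x := by
      nth_rw 1 [heq]
      simp
    rw [← h1, Set.mem_sdiff, Finset.mem_coe, h2, Set.mem_singleton_iff]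
    constructor
    · rintro ⟨⟨i, hi, rfl⟩, hne⟩
      exact ⟨i, hi, fun h => hne (by rw [h]), rfl⟩
    · rintro ⟨i, hi, hne, rfl⟩
      exact ⟨⟨i, hi, rfl⟩, fun h => hne (hD.pow_inj a (by omega) (by omega) h)⟩
  have hnext : ∀ K K' : Finset S, Apart c K K' → (∀ x, x ∈ K ∨ x ∈ K' ↔
      ∃ i < I.card, i ≠ j ∧ (c ^ i) a = x) → ∀ i, (c ^ i) a ∈ K → i + 1 < I.card → i + 1 ≠ j →
      (c ^ (i + 1)) a ∈ K := by
    intro K K' hap hm i hi hi1 hi2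
    refine ((hm _).2 ⟨i + 1, hi1, hi2, rfl⟩).resolve_right fun h => ?_
    refine hap _ hi _ h (Or.inr (Or.inl ?_))
    rw [← Equiv.Perm.mul_apply, ← pow_succ']
  have hrun : ∀ K K' : Finset S, Apart c K K' → (∀ x, x ∈ K ∨ x ∈ K' ↔
      ∃ i < I.card, i ≠ j ∧ (c ^ i) a = x) → (c ^ (j + 1)) a ∈ K →
      ∀ i, j < i → i < I.card → (c ^ i) a ∈ K := by
    intro K K' hap hm h0 i hi
    induction i, hi using Nat.le_induction with
    | base => exact fun _ => h0
    | succ i hi ih => exact fun h => hnext K K' hap hm i (ih (by omega)) h (by omega)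
  have hI'0 := (hD.mem_oddIntervals.1 hI').1.nonempty
  have hI''0 := (hD.mem_oddIntervals.1 hI'').1.nonempty
  have hdis : ∀ x, x ∈ I' → x ∉ I'' := fun x h h' => hsp x h x h' (Or.inl rfl)
  have hm' : ∀ x, x ∈ I'' ∨ x ∈ I' ↔ ∃ i < I.card, i ≠ j ∧ (c ^ i) a = x :=
    fun x => by rw [or_comm]; exact hmem x
  rcases hwl with rfl | ha
  · -- removing the first point leaves a single arc
    exfalso
    obtain ⟨x, hx⟩ := hI'0
    obtain ⟨y, hy⟩ := hI''0
    obtain ⟨i, hi, hi0, rfl⟩ := (hmem x).1 (Or.inl hx)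
    obtain ⟨k, hk, hk0, rfl⟩ := (hmem y).1 (Or.inr hy)
    rcases (hmem ((c ^ (0 + 1)) a)).2 ⟨0 + 1, by omega, by omega, rfl⟩ with h | h
    · exact hdis _ (hrun _ _ hsp hmem h k (by omega) hk) hy
    · exact hdis _ hx (hrun _ _ hsp.symm hm' h i (by omega) hi)
  · by_cases hj0 : j = 0
    · subst hj0
      obtain ⟨i, hi, hi0, hia⟩ := (hmem a).1 (Or.inl ha)
      exact absurd (hD.pow_inj a (i := i) (j := 0) (by omega) (by omega) (by simpa using hia)) hi0
    have hfirst : ∀ i < j, (c ^ i) a ∈ I' := by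
      intro i hi
      induction i with
      | zero => simpa using ha
      | succ i ih => exact hnext I' I'' hsp hmem i (ih (by omega)) (by omega) (by omega)
    have hI'eq : I' = (Finset.range j).image fun i => (c ^ i) a := by
      ext x
      simp only [Finset.mem_image, Finset.mem_range]
      refine ⟨fun hx => ?_, fun ⟨i, hi, h⟩ => h ▸ hfirst i hi⟩
      obtain ⟨i, hi, hij, rfl⟩ := (hmem x).1 (Or.inl hx)
      refine ⟨i, ?_, rfl⟩
      by_contra hcon
      obtain ⟨y, hy⟩ := hI''0
      obtain ⟨k, hk, hkj, rfl⟩ := (hmem y).1 (Or.inr hy)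
      have hkj' : j < k := by
        by_contra h
        exact hdis _ (hfirst k (by omega)) hy
      rcases (hmem ((c ^ (j + 1)) a)).2 ⟨j + 1, by omega, by omega, rfl⟩ with h | h
      · exact hdis _ (hrun _ _ hsp hmem h k hkj' hk) hy
      · exact hdis _ hx (hrun _ _ hsp.symm hm' h i (by omega) hi)
    have := (hD.mem_oddIntervals.1 hI').2
    rw [hI'eq, Finset.card_image_of_injOn, Finset.card_range] at this
    · exact this
    · intro x hx y hy hxy
      simp only [Finset.coe_range, Set.mem_Iio] at hx hy
      exact hD.pow_inj a (by omega) (by omega) hxy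

/-- The elements of `φ(V)` are the admissible families: given `(P₀)`, condition `(P₁)` says that
between two neighbouring points through which the same members pass there is no member at all,
so that the number of members through a point is a height function. -/
theorem mem_phi_iff (hD : D.IsCircular c) : B ∈ D.phi ↔ IsAdmissible c B := by
  constructor
  · rintro ⟨hodd, hP0, hP1⟩
    have hlam : IsLaminar c B := by
      refine ⟨fun I hI => (hD.mem_oddIntervals.1 (hodd I hI)).1,
        fun I hI => (hD.mem_oddIntervals.1 (hodd I hI)).2, fun I hI J hJ => ?_⟩
      have := hP0 I hI J hJ
      rwa [hD.spade_iff (hodd I hI) (hodd J hJ), hD.prec_iff (hodd I hI) (hodd J hJ),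
        hD.prec_iff (hodd J hJ) (hodd I hI)] at this
    refine ⟨hlam, fun t => ?_⟩
    by_cases h : ∃ I ∈ B, ¬ (t ∈ I ↔ c t ∈ I)
    · obtain ⟨I, hI, hIt⟩ := h
      have := hlam.sum_sub_sum (fun _ => 1) hI hIt
      rw [← g_eq_sum, ← g_eq_sum] at this
      exact Or.inr this
    · push Not at h
      have heq : (B.filter fun I => t ∈ I) = B.filter fun I => c t ∈ I := Finset.filter_congr h
      suffices h0 : (B.filter fun I => t ∈ I) = ∅ by
        left
        simp only [g, ← heq, h0]
        simp
      by_contra hne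
      obtain ⟨I, hI, hmin⟩ := Finset.exists_min_image _ Finset.card
        (Finset.nonempty_iff_ne_empty.2 hne)
      rw [Finset.mem_filter] at hI
      obtain ⟨C, hCB, -, hCI, hCev⟩ := hP1 I hI.1
      obtain ⟨a, -, -, hlt, hIeq⟩ := hD.arc_eq (hlam.arc I hI.1)
      have hct := (h I hI.1).1 hI.2
      obtain ⟨j, hj, hjt⟩ : ∃ j < I.card, (c ^ j) a = t := by
        have := hI.2; rw [hIeq] at this; simpa using this
      obtain ⟨j', hj', hjt'⟩ : ∃ j < I.card, (c ^ j) a = c t := by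
        have := hct; rw [hIeq] at this; simpa using this
      have hjt'' := hjt'
      rw [← hjt, ← Equiv.Perm.mul_apply, ← pow_succ'] at hjt'
      have hjj := hD.pow_inj a (by omega) (by omega) hjt'
      have ho := hlam.odd I hI.1
      have hev : t ∈ D.evenPart I ∨ c t ∈ D.evenPart I := by
        rcases Nat.even_or_odd j with he | he
        · right
          rw [← hjt'']
          refine hD.pow_mem_evenPart hlt hIeq ho (by rw [hjj]; exact he.add_one) ?_
          rw [Nat.even_iff] at he; rw [Nat.odd_iff] at ho; omega
        · left
          rw [← hjt]
          exact hD.pow_mem_evenPart hlt hIeq ho he (by omega)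
      have hK : ∃ K ∈ C, t ∈ K := by
        rcases hev with h1 | h1
        · obtain ⟨K, hK, hK'⟩ := by simpa using hCev h1
          exact ⟨K, hK, hK'⟩
        · obtain ⟨K, hK, hK'⟩ := by simpa using hCev h1
          exact ⟨K, hK, (h K (hCB hK)).2 hK'⟩
      obtain ⟨K, hK, htK⟩ := hK
      have h1 := Finset.card_lt_card (hCI K hK).1
      have h2 := hmin K (Finset.mem_filter.2 ⟨hCB hK, htK⟩)
      omega
  · intro hB
    have hodd : ∀ I ∈ B, I ∈ D.oddIntervals := fun I hI =>
      hD.mem_oddIntervals.2 ⟨hB.arc I hI, hB.odd I hI⟩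
    refine ⟨hodd, fun I hI J hJ => ?_, fun I hI => ?_⟩
    · rw [hD.spade_iff (hodd I hI) (hodd J hJ), hD.prec_iff (hodd I hI) (hodd J hJ),
        hD.prec_iff (hodd J hJ) (hodd I hI)]
      exact hB.nested I hI J hJ
    · classical
      -- the maximal members strictly inside `I`
      refine ⟨B.filter fun J => J ⊂ I ∧ ∀ K ∈ B, K ⊂ I → J ⊆ K → J = K, Finset.filter_subset _ _,
        fun J hJ K hK hne => ?_, fun J hJ => ?_, fun s hs => ?_⟩
      · rw [Finset.mem_filter] at hJ hK
        refine Finset.disjoint_left.2 fun x hx hx' => hne ?_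
        rcases hB.subset_or_subset hJ.1 hK.1 hx hx' with h | h
        · exact hJ.2.2 K hK.1 hK.2.1 h
        · exact (hK.2.2 J hJ.1 hJ.2.1 h).symm
      · rw [Finset.mem_filter] at hJ
        exact (hD.prec_iff (hodd J hJ.1) (hodd I hI)).2 (hB.inside_of_ssubset hJ.1 hI hJ.2.1)
      · obtain ⟨a, ha, ha', hlt, hIeq⟩ := hD.arc_eq (hB.arc I hI)
        have hmem : ∀ i < I.card, (c ^ i) a ∈ I := fun i hi => by
          rw [hIeq]; exact Finset.mem_image_of_mem _ (Finset.mem_range.2 hi)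
        obtain ⟨j, hj, rfl⟩ : ∃ j < I.card, (c ^ j) a = s := by
          have := hs.1; rw [hIeq] at this; simpa using this
        have hjo := hD.odd_of_pow_mem_evenPart hlt hIeq hj hs
        have hex : ∃ J ∈ B, J ⊂ I ∧ (c ^ j) a ∈ J := by
          by_contra hcon
          push Not at hcon
          have h1 : g ((c ^ j) a) B = g a B := by
            refine congrArg Finset.card (Finset.filter_congr fun J hJ => ⟨fun h => ?_, fun h => ?_⟩)
            · rcases hB.subset_or_subset hI hJ (hmem j hj) h with h1 | h1
              · exact h1 ha
              · by_cases h2 : J = I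
                · rwa [h2]
                · exact absurd h (hcon J hJ (h1.ssubset_of_ne h2))
            · rcases hB.subset_or_subset hI hJ ha h with h1 | h1
              · exact h1 (hmem j hj)
              · by_cases h2 : J = I
                · rw [h2]; exact hmem j hj
                · exact absurd (hB.inside_of_ssubset hJ hI (h1.ssubset_of_ne h2) a h _
                    (Or.inr (Or.inr (by simp)))) ha'
          have h2 := hB.height.parity a j fun i hi => by
            have : 0 < g ((c ^ i) a) B :=
              Finset.card_pos.2 ⟨I, Finset.mem_filter.2 ⟨hI, hmem i (by omega)⟩⟩
            omega
          rw [h1, Nat.odd_iff] at *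
          omega
        obtain ⟨J, hJ, hmax⟩ := (B.filter fun J => J ⊂ I ∧ (c ^ j) a ∈ J).exists_max_image
          Finset.card (by obtain ⟨J, h1, h2⟩ := hex; exact ⟨J, Finset.mem_filter.2 ⟨h1, h2⟩⟩)
        rw [Finset.mem_filter] at hJ
        simp only [Set.mem_iUnion]
        refine ⟨J, Finset.mem_filter.2 ⟨hJ.1, hJ.2.1, fun K hK hKI hJK => ?_⟩, hJ.2.2⟩
        exact Finset.eq_of_subset_of_card_le hJK
          (hmax K (Finset.mem_filter.2 ⟨hK, hKI, hJK hJ.2.2⟩))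

end IsCircular

/-! ### Perfectness of circular triples -/

section Coefficients

variable {S V : Type*} [Fintype S] [DecidableEq S] [AddCommGroup V] [Module (ZMod 2) V]
  (D : SymplecticTriple S V) {B : Finset (Finset S)}

theorem eps_eq (B : Finset (Finset S)) : D.eps B = ∑ s, tri (g s B) • D.e s := by
  unfold eps; simp only [tri_natCast]

theorem sum_smul_vec (r : Finset S → ZMod 2) :
    ∑ I ∈ B, r I • D.vec I = ∑ s, (∑ I ∈ B with s ∈ I, r I) • D.e s := by
  have : ∀ I, r I • D.vec I = ∑ s, (if s ∈ I then r I else 0) • D.e s := by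
    intro I
    simp only [vec, Finset.smul_sum, ite_smul, zero_smul, Finset.sum_ite_mem, Finset.univ_inter]
  simp only [this, Finset.sum_filter, Finset.sum_smul]
  rw [Finset.sum_comm]

theorem mem_span_iff {x : V} :
    x ∈ D.span B ↔ ∃ r : Finset S → ZMod 2, ∑ I ∈ B, r I • D.vec I = x :=
  Submodule.mem_span_image_finset_iff_exists_fun' _

theorem eps_eq_sum_depth {c : Equiv.Perm S} (hB : IsLaminar c B) :
    D.eps B = ∑ I ∈ B, (depth B I : ZMod 2) • D.vec I := by
  rw [sum_smul_vec]
  unfold eps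
  simp only [← hB.sum_depth]
  push_cast
  rfl

end Coefficients

/-- At an end of a member `I` of a laminar family, the coefficient function of `∑ r_J e_J` jumps
by `r_I`. -/
theorem IsLaminar.coeff_add_coeff {S : Type*} [DecidableEq S] {c : Equiv.Perm S}
    {B : Finset (Finset S)} (hB : IsLaminar c B) (r : Finset S → ZMod 2) {I : Finset S} (hI : I ∈ B)
    {t : S} (ht : ¬ (t ∈ I ↔ c t ∈ I)) :
    ∑ J ∈ B with t ∈ J, r J + ∑ J ∈ B with c t ∈ J, r J = r I := by
  rw [Finset.sum_filter, Finset.sum_filter, ← Finset.sum_add_distrib,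
    Finset.sum_eq_single_of_mem I hI]
  · by_cases h1 : t ∈ I <;> by_cases h2 : c t ∈ I <;> simp [h1, h2] at ht ⊢
  · intro J hJ hne
    have : t ∈ J ↔ c t ∈ J := by
      by_contra hcon
      exact hne (hB.eq_of_end hJ hI hcon ht)
    by_cases h1 : c t ∈ J <;> simp [this, h1, CharTwo.add_self_eq_zero]

namespace IsCircular

variable {S V : Type*} [Fintype S] [DecidableEq S] [AddCommGroup V] [Module (ZMod 2) V]
  {D : SymplecticTriple S V} {c : Equiv.Perm S} {B B' : Finset (Finset S)}

/-- If `ε(B') - x` is a multiple of `∑ e_s` with `x ∈ L_B`, then `g(B') ≤ g(B)`, and `ε(B')` and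
`x` have the same coefficients. -/
theorem g_le_and_tri_eq (hD : D.IsCircular c) (hB : IsAdmissible c B) (hB' : IsAdmissible c B')
    (r : Finset S → ZMod 2) (b : ZMod 2)
    (h : ∀ s, tri (g s B') = (∑ I ∈ B with s ∈ I, r I) + b) (s : S) :
    g s B' ≤ g s B ∧ tri (g s B') = ∑ I ∈ B with s ∈ I, r I := by
  obtain ⟨y, hy, hyg, hyr⟩ := hB.exists_height r
  have := hy.eq_or_eq hD.toOddCycle hB'.height b (fun s => by rw [h, hyr]) s
  have h1 := abs_le.1 (hyg s)
  refine ⟨by omega, ?_⟩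
  rcases this with h | h
  · rw [h, hyr]
  · rw [h, tri_neg_one_sub, hyr]

theorem linearIndependent_vec
    (hker : ∀ a : S → ZMod 2, ∑ s, a s • D.e s = 0 → ∀ s t, a s = a t)
    (hB : IsLaminar c B) :
    LinearIndependent (ZMod 2) fun I : {I // I ∈ B} => D.vec I.1 := by
  change LinearIndepOn (ZMod 2) D.vec (B : Set (Finset S))
  rw [linearIndepOn_finset_iff]
  intro r hr I hI
  rw [sum_smul_vec] at hr
  obtain ⟨t, ht, ht'⟩ := (hB.arc I hI).exists
  have h1 := hB.coeff_add_coeff r hI (t := t) (by simp [ht, ht'])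
  rw [hker _ hr t (c t), CharTwo.add_self_eq_zero] at h1
  exact h1.symm

/-- The ends of an odd arc `J` with `e_J ∈ L_B` are those of a member of `B`; an arc with the same
ends is `J` or its complement, and the latter has even cardinality. -/
theorem mem_of_vec_mem_span (hD : D.IsCircular c)
    (hker : ∀ a : S → ZMod 2, ∑ s, a s • D.e s = 0 → ∀ s t, a s = a t)
    (hB : IsLaminar c B) {J : Finset S}
    (hJ : IsArc c J) (hJo : Odd J.card) (h : D.vec J ∈ D.span B) : J ∈ B := by
  obtain ⟨r, hr⟩ := D.mem_span_iff.1 h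
  have hconst : ∀ s t, (∑ I ∈ B with s ∈ I, r I) + (if s ∈ J then 1 else 0) =
      (∑ I ∈ B with t ∈ I, r I) + (if t ∈ J then 1 else 0) := by
    refine hker (fun s => (∑ I ∈ B with s ∈ I, r I) + (if s ∈ J then 1 else 0)) ?_
    have h1 : D.vec J = ∑ s, (if s ∈ J then (1 : ZMod 2) else 0) • D.e s := by
      simp [vec]
    simp only [add_smul, Finset.sum_add_distrib, ← sum_smul_vec, ← h1, hr]
    rw [← two_smul (ZMod 2)]
    exact zero_smul _ _
  have hends : ∀ I ∈ B, r I = 1 → ∀ t, ¬ (t ∈ I ↔ c t ∈ I) → ¬ (t ∈ J ↔ c t ∈ J) := by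
    intro I hI hrI t ht htJ
    have h1 := hB.coeff_add_coeff r hI ht
    have h2 := hconst t (c t)
    simp only [htJ, add_left_inj] at h2
    rw [h2, CharTwo.add_self_eq_zero, hrI] at h1
    exact zero_ne_one h1
  obtain ⟨v, hv, hv'⟩ := hJ.exists
  obtain ⟨u, hu, hu'⟩ := hJ.exists_entry
  -- some `I` with `r_I = 1` ends where `J` is left
  obtain ⟨I, hI, hrI⟩ : ∃ I ∈ B, r I = 1 := by
    by_contra hcon
    push Not at hcon
    have h0 : ∀ s, ∑ I ∈ B with s ∈ I, r I = 0 := fun s => Finset.sum_eq_zero fun I hI => by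
      have := hcon I (Finset.mem_filter.1 hI).1
      revert this; generalize r I = x; revert x; decide
    have := hconst v (c v)
    simp [h0, hv, hv'] at this
  obtain ⟨v', hw, hw'⟩ := (hB.arc I hI).exists
  obtain ⟨u', hx, hx'⟩ := (hB.arc I hI).exists_entry
  have hJend : ∀ t, ¬ (t ∈ J ↔ c t ∈ J) → t = v ∨ t = u := by
    intro t ht
    by_cases h1 : t ∈ J
    · exact Or.inl (hJ.exit_unique h1 (fun h => ht (by simp [h1, h])) hv hv')
    · exact Or.inr (hJ.entry_unique h1 (by by_contra h; exact ht (by simp [h1, h])) hu hu')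
  have hv1 := hJend v' (hends I hI hrI v' (by simp [hw, hw']))
  have hu1 := hJend u' (hends I hI hrI u' (by simp [hx, hx']))
  have hne : v' ≠ u' := fun h => hx (h ▸ hw)
  have key : ∀ t, (t ∈ I ↔ c t ∈ I) ↔ (t ∈ J ↔ c t ∈ J) := by
    intro t
    rw [← not_iff_not]
    refine ⟨hends I hI hrI t, fun ht => ?_⟩
    have h2 : t = v' ∨ t = u' := by
      rcases hJend t ht with rfl | rfl <;> rcases hv1 with rfl | rfl <;>
        rcases hu1 with rfl | rfl <;> simp_all
    rcases h2 with rfl | rfl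
    · simp [hw, hw']
    · simp [hx, hx']
  rcases hD.eq_or_eq_compl key with h1 | h1
  · rwa [← h1]
  · exfalso
    have h2 := Finset.card_compl_add_card J
    rw [← h1] at h2
    have h3 := hD.odd
    rw [← h2, Nat.odd_add] at h3
    exact Nat.not_even_iff_odd.2 hJo (h3.1 (hB.odd I hI))

/-- A circular triple in which the only possible linear relation between the vectors `e_s` is
`∑ e_s = 0` is perfect. -/
theorem perfect (hD : D.IsCircular c)
    (hker : ∀ a : S → ZMod 2, ∑ s, a s • D.e s = 0 → ∀ s t, a s = a t) : D.Perfect := by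
  have hconst : ∀ a b : S → ZMod 2, ∑ s, a s • D.e s = ∑ s, b s • D.e s →
      ∃ k, ∀ s, a s = b s + k := by
    intro a b hab
    have h0 : 0 < Fintype.card S := by have := hD.three_le; omega
    obtain ⟨s₀⟩ := Fintype.card_pos_iff.1 h0
    have h1 := hker (fun s => a s - b s) (by simp [sub_smul, hab])
    exact ⟨a s₀ - b s₀, fun s => by rw [← h1 s s₀]; ring⟩
  refine ⟨fun B hB => ?_, fun B hB => ?_, fun B hB => ?_, ⟨fun B hB => ?_, fun B hB B' hB' h => ?_,
    fun x hx => ?_⟩, fun B hB B' hB' h => ?_⟩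
  · exact linearIndependent_vec hker (hD.mem_phi_iff.1 hB).toIsLaminar
  · have hB2 := hD.mem_phi_iff.1 hB
    ext J
    refine ⟨fun h => ⟨hB.1 J h, Submodule.subset_span (Set.mem_image_of_mem _ h)⟩, fun h => ?_⟩
    have h1 := hD.mem_oddIntervals.1 h.1
    exact hD.mem_of_vec_mem_span hker hB2.toIsLaminar h1.1 h1.2 h.2
  · have hB2 := hD.mem_phi_iff.1 hB
    exact D.mem_span_iff.2 ⟨_, (D.eps_eq_sum_depth hB2.toIsLaminar).symm⟩
  · have hB2 := hD.mem_phi_iff.1 hB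
    exact Set.mem_biUnion hB (D.mem_span_iff.2 ⟨_, (D.eps_eq_sum_depth hB2.toIsLaminar).symm⟩)
  · rw [hD.mem_phi_iff] at hB hB'
    rw [eps_eq, eps_eq] at h
    obtain ⟨k, hk⟩ := hconst _ _ h
    refine hB.eq_of_g_eq hD.toOddCycle hB' fun s => ?_
    have := hB'.height.eq_or_eq hD.toOddCycle hB.height k hk s
    omega
  · obtain ⟨B, hB, hxB⟩ := Set.mem_iUnion₂.1 hx
    have hB2 := hD.mem_phi_iff.1 hB
    obtain ⟨r, rfl⟩ := D.mem_span_iff.1 hxB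
    obtain ⟨h, hh, b, hb⟩ := exists_isHeight hD.toOddCycle fun s => ∑ I ∈ B with s ∈ I, r I
    have hadm := isAdmissible_ofHeight hD.toOddCycle hh
    refine ⟨ofHeight c h, hD.mem_phi_iff.2 hadm, ?_⟩
    rw [eps_eq, sum_smul_vec]
    refine Finset.sum_congr rfl fun s _ => ?_
    rw [(hD.g_le_and_tri_eq hB2 hadm r b (fun s => by rw [g_ofHeight hD.toOddCycle hh, hb]) s).2]
  · rw [hD.mem_phi_iff] at hB hB'
    obtain ⟨r, hr⟩ := D.mem_span_iff.1 h
    rw [eps_eq, sum_smul_vec] at hr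
    obtain ⟨k, hk⟩ := hconst _ _ hr.symm
    exact fun s => (hD.g_le_and_tri_eq hB hB' r k hk s).1

/-- If the vectors `e_s` span `V` and have sum zero, then every vector is some `ε(B)`. -/
theorem V0_eq_univ (hD : D.IsCircular c) (hspan : ⊤ ≤ Submodule.span (ZMod 2) (Set.range D.e))
    (hsum : ∑ s, D.e s = 0) : D.V0 = Set.univ := by
  refine Set.eq_univ_of_forall fun x => ?_
  obtain ⟨a, rfl⟩ := (Submodule.mem_span_range_iff_exists_fun (ZMod 2)).1
    (hspan (Submodule.mem_top (x := x)))
  obtain ⟨h, hh, b, hb⟩ := exists_isHeight hD.toOddCycle a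
  have hadm := isAdmissible_ofHeight hD.toOddCycle hh
  have h1 : D.eps (ofHeight c h) = ∑ s, a s • D.e s := by
    simp only [eps_eq, g_ofHeight hD.toOddCycle hh, hb, add_smul, Finset.sum_add_distrib,
      ← Finset.smul_sum, hsum, smul_zero, add_zero]
  rw [← h1, D.eps_eq_sum_depth hadm.toIsLaminar]
  exact Set.mem_biUnion (hD.mem_phi_iff.2 hadm) (D.mem_span_iff.2 ⟨_, rfl⟩)

end IsCircular

/-! ### Transport along graph embeddings -/

section Transport

variable {S S' V V' : Type*} [DecidableEq S] [DecidableEq S'] [AddCommGroup V]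
  [Module (ZMod 2) V] [AddCommGroup V'] [Module (ZMod 2) V'] {D : SymplecticTriple S V}
  {D' : SymplecticTriple S' V'}

theorem nonempty_induce_iso (ι : D.graph ↪g D'.graph) (A : Set S) :
    Nonempty (D.graph.induce A ≃g D'.graph.induce (ι '' A)) :=
  ⟨⟨Equiv.Set.image ι A ι.injective, fun {a b} => ι.map_adj_iff (v := a.1) (w := b.1)⟩⟩

theorem image_image_injective (ι : D.graph ↪g D'.graph) :
    Function.Injective fun I : Finset S => I.image ι := Finset.image_injective ι.injective

theorem mem_oddIntervals_image (ι : D.graph ↪g D'.graph) {I : Finset S} :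
    I.image ι ∈ D'.oddIntervals ↔ I ∈ D.oddIntervals := by
  have hψ := nonempty_induce_iso ι (I : Set S)
  rw [← Finset.coe_image] at hψ
  obtain ⟨ψ⟩ := hψ
  unfold oddIntervals IsTypeA
  simp only [Set.mem_ofPred_eq, Finset.card_image_of_injective _ ι.injective]
  refine and_congr_left fun _ => exists_congr fun m => and_congr_right fun _ => ?_
  exact ⟨fun ⟨φ⟩ => ⟨φ.comp ψ⟩, fun ⟨φ⟩ => ⟨φ.comp ψ.symm⟩⟩

theorem disconnected_image (ι : D.graph ↪g D'.graph) {A : Set S} :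
    D'.Disconnected (ι '' A) ↔ D.Disconnected A := by
  obtain ⟨ψ⟩ := nonempty_induce_iso ι A
  exact not_congr ψ.connected_iff.symm

theorem prec_image (ι : D.graph ↪g D'.graph) {I J : Finset S} :
    D'.Prec (I.image ι) (J.image ι) ↔ D.Prec I J := by
  unfold Prec
  rw [Finset.coe_image, Finset.coe_image, ← Set.image_sdiff ι.injective, disconnected_image,
    Finset.ssubset_iff_subset_ne, Finset.image_subset_image_iff ι.injective,
    (image_image_injective ι).ne_iff, ← Finset.ssubset_iff_subset_ne]

theorem spade_image (ι : D.graph ↪g D'.graph) {I J : Finset S} :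
    D'.Spade (I.image ι) (J.image ι) ↔ D.Spade I J := by
  unfold Spade
  rw [Finset.coe_image, Finset.coe_image, ← Set.image_union, disconnected_image,
    Finset.disjoint_image ι.injective]

theorem evenPart_image (ι : D.graph ↪g D'.graph) (I : Finset S) :
    D'.evenPart (I.image ι) = ι '' D.evenPart I := by
  have key : ∀ s (J K : Finset S), ((I.image ι : Finset S') : Set S') \ {ι s} =
      ((J.image ι : Finset S') : Set S') ∪ ((K.image ι : Finset S') : Set S') ↔
      (I : Set S) \ {s} = (J : Set S) ∪ (K : Set S) := by
    intro s J K
    rw [Finset.coe_image, Finset.coe_image, Finset.coe_image, ← Set.image_singleton,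
      ← Set.image_sdiff ι.injective, ← Set.image_union, (Set.image_injective.2 ι.injective).eq_iff]
  ext x
  constructor
  · rintro ⟨hx, I', hI', I'', hI'', hsp, heq⟩
    obtain ⟨s, hs, rfl⟩ := Finset.mem_image.1 hx
    have h1 : I' ⊆ I.image ι := fun y hy =>
      (heq.symm ▸ Or.inl hy : y ∈ ((I.image ι : Finset S') : Set S') \ {ι s}).1
    have h2 : I'' ⊆ I.image ι := fun y hy =>
      (heq.symm ▸ Or.inr hy : y ∈ ((I.image ι : Finset S') : Set S') \ {ι s}).1
    obtain ⟨J, -, rfl⟩ := Finset.subset_image_iff.1 h1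
    obtain ⟨K, -, rfl⟩ := Finset.subset_image_iff.1 h2
    rw [mem_oddIntervals_image] at hI' hI''
    exact ⟨s, ⟨hs, J, hI', K, hI'', (spade_image ι).1 hsp, (key _ _ _).1 heq⟩, rfl⟩
  · rintro ⟨s, ⟨hs, J, hJ, K, hK, hsp, heq⟩, rfl⟩
    exact ⟨Finset.mem_image_of_mem _ hs, _, (mem_oddIntervals_image ι).2 hJ, _,
      (mem_oddIntervals_image ι).2 hK, (spade_image ι).2 hsp, (key _ _ _).2 heq⟩

/-- The conditions defining `φ` depend on the graph only. -/
theorem image_mem_phi (ι : D.graph ↪g D'.graph) {B : Finset (Finset S)} :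
    B.image (fun I => I.image ι) ∈ D'.phi ↔ B ∈ D.phi := by
  have hinj := image_image_injective ι
  have hcover : ∀ (I : Finset S) (C : Finset (Finset S)),
      D'.evenPart (I.image ι) ⊆
          ⋃ J ∈ (C.image fun I => I.image ι : Finset (Finset S')), (J : Set S') ↔
        D.evenPart I ⊆ ⋃ J ∈ C, (J : Set S) := by
    intro I C
    have : (⋃ J ∈ (C.image fun I => I.image ι : Finset (Finset S')), (J : Set S')) =
        ι '' ⋃ J ∈ C, (J : Set S) := by
      ext x; simp [Set.image_iUnion]
    rw [evenPart_image, this, Set.image_subset_image_iff ι.injective]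
  refine and_congr ?_ (and_congr ?_ ?_)
  · simp only [Finset.forall_mem_image, mem_oddIntervals_image]
  · simp only [P0, Finset.forall_mem_image, spade_image, prec_image, hinj.eq_iff]
  · simp only [P1, Finset.forall_mem_image]
    refine forall₂_congr fun I hI => ⟨?_, ?_⟩
    · rintro ⟨C, hCB, h1, h2, h3⟩
      obtain ⟨C, hCB', rfl⟩ := Finset.subset_image_iff.1 hCB
      simp only [Finset.forall_mem_image, hinj.ne_iff, Finset.disjoint_image ι.injective,
        prec_image] at h1 h2
      exact ⟨C, hCB', h1, h2, (hcover I C).1 h3⟩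
    · rintro ⟨C, hCB, h1, h2, h3⟩
      have h3' := (hcover I C).2 h3
      refine ⟨_, Finset.image_subset_image hCB, ?_, ?_, h3'⟩
      · simpa only [Finset.forall_mem_image, hinj.ne_iff, Finset.disjoint_image ι.injective]
      · simpa only [Finset.forall_mem_image, prec_image]

theorem g_image {f : S → S'} (hf : Function.Injective f) (s : S) (B : Finset (Finset S)) :
    g (f s) (B.image fun I => I.image f) = g s B := by
  unfold g
  rw [Finset.filter_image, Finset.card_image_of_injective _ (Finset.image_injective hf)]
  simp [hf.eq_iff]

theorem vec_image {f : S → S'} (hf : Function.Injective f) {T : V →ₗ[ZMod 2] V'}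
    (hT : ∀ s, T (D.e s) = D'.e (f s)) (I : Finset S) : D'.vec (I.image f) = T (D.vec I) := by
  unfold vec
  rw [Finset.sum_image hf.injOn, map_sum]
  simp only [hT]

theorem span_image {f : S → S'} (hf : Function.Injective f) {T : V →ₗ[ZMod 2] V'}
    (hT : ∀ s, T (D.e s) = D'.e (f s)) (B : Finset (Finset S)) :
    D'.span (B.image fun I => I.image f) = (D.span B).map T := by
  unfold span
  rw [Submodule.map_span, Finset.coe_image, Set.image_image, Set.image_image]
  simp only [vec_image hf hT]

end Transport

section Equivariance

variable {S V : Type*} [Fintype S] [DecidableEq S] [AddCommGroup V] [Module (ZMod 2) V]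
  {D : SymplecticTriple S V}

theorem eps_image_equiv (σ : S ≃ S) {T : V →ₗ[ZMod 2] V} (hT : ∀ s, T (D.e s) = D.e (σ s))
    (B : Finset (Finset S)) : D.eps (B.image fun I => I.image σ) = T (D.eps B) := by
  unfold eps
  rw [← Equiv.sum_comp σ, map_sum]
  simp only [g_image σ.injective, map_smul, hT]

theorem CyclicCase.exists_equiv {N : ℕ} (h : D.CyclicCase N) (σ : S ≃ S) :
    ∃ T : (V ⧸ Submodule.span (ZMod 2) {D.vec Finset.univ}) ≃ₗ[ZMod 2]
      (V ⧸ Submodule.span (ZMod 2) {D.vec Finset.univ}), ∀ s, T (h.bar.e s) = h.bar.e (σ s) := by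
  let b := Module.Basis.mk h.indep h.spans
  let T₀ : V ≃ₗ[ZMod 2] V := b.equiv b σ
  have hT₀ : ∀ s, T₀ (D.e s) = D.e (σ s) := by
    intro s
    have h1 : ∀ s, b s = D.e s := fun s => Module.Basis.mk_apply _ _ _
    rw [← h1, ← h1]
    exact Module.Basis.equiv_apply _ _ _ _
  have hvec : T₀ (D.vec Finset.univ) = D.vec Finset.univ := by
    unfold vec
    rw [map_sum]
    simp only [hT₀]
    exact Equiv.sum_comp σ D.e
  refine ⟨Submodule.Quotient.equiv _ _ T₀ ?_, fun s => ?_⟩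
  · rw [Submodule.map_span, Set.image_singleton]
    exact congrArg _ (congrArg _ hvec)
  · change Submodule.mkQ _ (T₀ (D.e s)) = _
    rw [hT₀]
    rfl

end Equivariance

/-! ### Construction of the cyclic orientation -/

section Rotation

/-- A numbering of `S` by `Fin (n + 1)` orients it cyclically. -/
theorem oddCycle_conj {S : Type*} [Fintype S] {n : ℕ} (ψ : S ≃ Fin (n + 1)) (hodd : Odd (n + 1))
    (h3 : 3 ≤ n + 1) : OddCycle ((ψ.trans (finRotate (n + 1))).trans ψ.symm) := by
  have hcard : Fintype.card S = n + 1 := by rw [Fintype.card_congr ψ, Fintype.card_fin]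
  refine ⟨fun A ⟨a, ha⟩ hA => Set.eq_univ_of_forall fun x => ?_, by rwa [hcard], by rwa [hcard]⟩
  have key : ∀ k : Fin (n + 1), ψ.symm (ψ a + k) ∈ A := by
    intro k
    induction k using Fin.induction with
    | zero => simpa using ha
    | succ k ih =>
      have := hA _ ih
      rw [← Fin.coeSucc_eq_succ, ← add_assoc, ← finRotate_apply]
      simpa only [Equiv.trans_apply, Equiv.apply_symm_apply] using this
  have := key (ψ x - ψ a)
  rwa [add_sub_cancel, Equiv.symm_apply_apply] at this

theorem CyclicCase.exists_isCircular {S V : Type*} [Fintype S] [AddCommGroup V]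
    [Module (ZMod 2) V] {D : SymplecticTriple S V} {N : ℕ} (h : D.CyclicCase N) :
    ∃ c, D.IsCircular c := by
  obtain ⟨ψ⟩ := h.iso
  obtain ⟨n, rfl⟩ := Nat.exists_eq_add_of_le' h.three_le
  refine ⟨_, oddCycle_conj (n := n + 2) ψ.toEquiv h.odd (by omega), fun s t => ?_⟩
  rw [← ψ.map_adj_iff, SimpleGraph.cycleGraph_adj]
  simp only [Equiv.trans_apply, finRotate_apply, Equiv.eq_symm_apply, sub_eq_iff_eq_add']
  rw [or_comm]
  exact Iff.rfl

end Rotation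

/-! ### The cyclic cases -/

section Cyclic

variable {S V : Type*} [Fintype S] [DecidableEq S] [AddCommGroup V] [Module (ZMod 2) V]
  {D : SymplecticTriple S V} {N : ℕ}

theorem CyclicCase.perfect (h : D.CyclicCase N) : D.Perfect := by
  obtain ⟨c, hc⟩ := h.exists_isCircular
  refine hc.perfect fun a ha s t => ?_
  have := Fintype.linearIndependent_iff.1 h.indep a ha
  rw [this, this]

theorem CyclicCase.bar_isCircular (h : D.CyclicCase N) {c : Equiv.Perm S} (hc : D.IsCircular c) :
    h.bar.IsCircular c := ⟨hc.toOddCycle, hc.adj⟩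

theorem CyclicCase.bar_perfect (h : D.CyclicCase N) : h.bar.Perfect := by
  obtain ⟨c, hc⟩ := h.exists_isCircular
  refine (h.bar_isCircular hc).perfect fun a ha => ?_
  have h1 : Submodule.mkQ (Submodule.span (ZMod 2) {D.vec Finset.univ}) (∑ s, a s • D.e s) = 0 := by
    rw [← ha, map_sum]; rfl
  rw [Submodule.mkQ_apply, Submodule.Quotient.mk_eq_zero, Submodule.mem_span_singleton] at h1
  obtain ⟨r, hr⟩ := h1
  have h2 := Fintype.linearIndependent_iff.1 h.indep (fun s => a s - r) (by
    simp only [sub_smul, Finset.sum_sub_distrib, ← Finset.smul_sum]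
    rw [← hr]; simp [vec])
  intro s t
  rw [sub_eq_zero.1 (h2 s), sub_eq_zero.1 (h2 t)]

theorem CyclicCase.bar_V0 (h : D.CyclicCase N) : h.bar.V0 = Set.univ := by
  obtain ⟨c, hc⟩ := h.exists_isCircular
  refine (h.bar_isCircular hc).V0_eq_univ ?_ ?_
  · have h1 : Set.range h.bar.e = Submodule.mkQ (Submodule.span (ZMod 2) {D.vec Finset.univ}) ''
        Set.range D.e := by rw [← Set.range_comp]; rfl
    rw [h1, ← Submodule.map_span, top_le_iff.1 h.spans, Submodule.map_top, Submodule.range_mkQ]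
  · have h1 : ∑ s, h.bar.e s = Submodule.mkQ (Submodule.span (ZMod 2) {D.vec Finset.univ})
        (D.vec Finset.univ) := by unfold vec; rw [map_sum]; rfl
    rw [h1, Submodule.mkQ_apply, Submodule.Quotient.mk_eq_zero]
    exact Submodule.mem_span_singleton_self _

end Cyclic

/-! ### The linear case -/

section Linear

variable {S V : Type*} [Fintype S] [DecidableEq S] [AddCommGroup V] [Module (ZMod 2) V]
  {D : SymplecticTriple S V} {N : ℕ}

/-- The triple obtained by adjoining the vertex `none` with the vector `∑ e_s`. It turns a path
with an even number of vertices into a cycle. -/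
def close (D : SymplecticTriple S V) : SymplecticTriple (Option S) V where
  form := D.form
  alt := D.alt
  e j := j.elim (∑ s, D.e s) D.e

/-- The inclusion of the graph of a triple into that of its closure. -/
def closeEmbedding (D : SymplecticTriple S V) : D.graph ↪g D.close.graph where
  toFun := some
  inj' := Option.some_injective S
  map_rel_iff' := by
    intro a b
    change (some a ≠ some b ∧ _) ↔ (a ≠ b ∧ _)
    rw [(Option.some_injective S).ne_iff]
    exact Iff.rfl

open Classical in
/-- The degree of a vertex of a path modulo two is `1` exactly at the two ends. -/
theorem sum_pathGraph {n : ℕ} (hn : 2 ≤ n) (i : Fin n) :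
    (∑ j : Fin n, if (SimpleGraph.pathGraph n).Adj i j then (1 : ZMod 2) else 0) =
      if i.val = 0 ∨ i.val + 1 = n then 1 else 0 := by
  have h1 : ∀ j : Fin n, (if (SimpleGraph.pathGraph n).Adj i j then (1 : ZMod 2) else 0) =
      (if i.val + 1 = j.val then 1 else 0) + (if j.val + 1 = i.val then 1 else 0) := by
    intro j
    simp only [SimpleGraph.pathGraph_adj]
    split_ifs <;> first | omega | simp
  have h2 : (∑ j : Fin n, if i.val + 1 = j.val then (1 : ZMod 2) else 0) =
      if i.val + 1 < n then 1 else 0 := by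
    split_ifs with h
    · rw [Finset.sum_eq_single_of_mem (⟨i.val + 1, h⟩ : Fin n) (Finset.mem_univ _)]
      · simp
      · intro j _ hj
        rw [if_neg]
        intro h'
        exact hj (Fin.ext h'.symm)
    · exact Finset.sum_eq_zero fun j _ => if_neg (by omega)
  have h3 : (∑ j : Fin n, if j.val + 1 = i.val then (1 : ZMod 2) else 0) =
      if 0 < i.val then 1 else 0 := by
    split_ifs with h
    · rw [Finset.sum_eq_single_of_mem (⟨i.val - 1, by omega⟩ : Fin n) (Finset.mem_univ _)]
      · rw [if_pos]; simp only; omega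
      · intro j _ hj
        rw [if_neg]
        intro h'
        exact hj (Fin.ext (by simp only; omega))
    · exact Finset.sum_eq_zero fun j _ => if_neg (by omega)
  simp only [h1, Finset.sum_add_distrib, h2, h3]
  split_ifs <;> first | omega | rfl

theorem LinearCase.exists_isCircular (h : D.LinearCase N) : ∃ c, D.close.IsCircular c := by
  classical
  obtain ⟨φ⟩ := h.iso
  obtain ⟨n, rfl⟩ : ∃ n, N = n + 1 := ⟨N - 1, by have := h.three_le; omega⟩
  have hn : 2 ≤ n := by have := h.three_le; omega
  rw [Nat.add_sub_cancel] at φ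
  let ψ : Option S ≃ Fin (n + 1) := (Equiv.optionCongr φ.toEquiv).trans finSuccEquivLast.symm
  have ψsome : ∀ s, (ψ (some s)).val = (φ s).val := fun s => by simp [ψ]
  have ψnone : (ψ none).val = n := by simp [ψ]
  have hform : ∀ s t, D.form (D.e s) (D.e t) = if D.graph.Adj s t then 1 else 0 := by
    intro s t
    split_ifs with h1
    · exact h1.2
    · by_cases hst : s = t
      · rw [hst]; exact D.alt _
      · have h2 : ∀ x : ZMod 2, x ≠ 1 → x = 0 := by decide
        exact h2 _ fun h3 => h1 ⟨hst, h3⟩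
  have hsum : ∀ s, D.form (D.e s) (∑ t, D.e t) =
      if (φ s).val = 0 ∨ (φ s).val + 1 = n then 1 else 0 := by
    intro s
    rw [map_sum, ← sum_pathGraph hn, ← Equiv.sum_comp φ.toEquiv]
    refine Finset.sum_congr rfl fun t _ => ?_
    rw [hform]
    have : (SimpleGraph.pathGraph n).Adj (φ s) (φ.toEquiv t) ↔ D.graph.Adj s t := φ.map_adj_iff
    simp only [this]
  have hc : ∀ i j : Fin (n + 1), j = finRotate (n + 1) i ↔
      i.val + 1 = j.val ∨ (i.val = n ∧ j.val = 0) := by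
    intro i j
    rw [finRotate_apply, Fin.ext_iff]
    by_cases hi : i.val = n
    · have : i = Fin.last n := Fin.ext hi
      subst this
      simp
      omega
    · rw [Fin.val_add_one_of_lt (Fin.lt_def.2 (by simp; omega))]
      omega
  have hnone : ∀ s, D.close.graph.Adj (some s) none ↔
      (φ s).val = 0 ∨ (φ s).val + 1 = n := by
    intro s
    change (some s ≠ none ∧ D.form (D.e s) (∑ t, D.e t) = 1) ↔ _
    rw [hsum]
    split_ifs with h1 <;> simp [h1]
  refine ⟨_, oddCycle_conj ψ h.odd h.three_le, fun s t => ?_⟩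
  simp only [Equiv.trans_apply, Equiv.eq_symm_apply, hc]
  rcases s with _ | s <;> rcases t with _ | t
  · rw [ψnone]
    simp
    omega
  · rw [SimpleGraph.adj_comm, hnone, ψnone, ψsome]
    have := (φ t).2
    omega
  · rw [hnone, ψnone, ψsome]
    have := (φ s).2
    omega
  · have h1 : D.close.graph.Adj (some s) (some t) ↔ D.graph.Adj s t :=
      D.closeEmbedding.map_adj_iff
    rw [h1, ← φ.map_adj_iff, SimpleGraph.pathGraph_adj, ψsome, ψsome]
    have := (φ s).2
    have := (φ t).2
    omega

theorem g_none_image (B : Finset (Finset S)) : g none (B.image fun I => I.image some) = 0 := by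
  unfold g
  rw [Finset.card_eq_zero, Finset.filter_eq_empty_iff]
  simp

theorem eps_close (B : Finset (Finset S)) :
    D.close.eps (B.image fun I => I.image some) = D.eps B := by
  rw [eps_eq, eps_eq, Fintype.sum_option, g_none_image]
  simp only [g_image (Option.some_injective S)]
  have : tri ((0 : ℕ) : ℤ) = 0 := rfl
  rw [this, zero_smul, zero_add]
  rfl

theorem span_close (B : Finset (Finset S)) :
    D.close.span (B.image fun I => I.image some) = D.span B := by
  rw [span_image (D := D) (Option.some_injective S) (T := LinearMap.id) fun s => rfl]
  exact Submodule.map_id _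

/-- Perfectness passes from the closure to the triple itself: the families of the latter are those
families `B` of the former with `g_none(B) = 0`, a condition compatible with the comparison of the
functions `g`. -/
theorem Perfect.of_close (h : D.close.Perfect) : D.Perfect := by
  have hphi : ∀ {B}, B.image (fun I => I.image some) ∈ D.close.phi ↔ B ∈ D.phi :=
    image_mem_phi D.closeEmbedding
  have hodd : ∀ {I}, I.image some ∈ D.close.oddIntervals ↔ I ∈ D.oddIntervals :=
    mem_oddIntervals_image D.closeEmbedding
  have hvec : ∀ I : Finset S, D.close.vec (I.image some) = D.vec I := fun I =>
    vec_image (D := D) (Option.some_injective S) (T := LinearMap.id) (fun s => rfl) I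
  have hinj : Function.Injective fun I : Finset S => I.image some :=
    Finset.image_injective (Option.some_injective S)
  refine ⟨fun B hB => ?_, fun B hB => ?_, fun B hB => ?_, ⟨fun B hB => ?_, fun B hB B' hB' hBB => ?_,
    fun x hx => ?_⟩, fun B hB B' hB' hBB s => ?_⟩
  · have h1 := h.basis _ (hphi.2 hB)
    have h2 := h1.comp (fun I : {I // I ∈ B} => ⟨I.1.image some, Finset.mem_image_of_mem _ I.2⟩)
      (fun I J hIJ => Subtype.ext (hinj (congrArg Subtype.val hIJ)))
    convert h2 using 2 with I
    exact (hvec I.1).symm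
  · ext J
    have h1 := Set.ext_iff.1 (h.eq_members _ (hphi.2 hB)) (J.image some)
    rw [Finset.mem_coe, hinj.mem_finset_image] at h1
    rw [Finset.mem_coe, h1]
    unfold members
    simp only [Set.mem_ofPred_eq, hodd, hvec, span_close]
  · rw [← eps_close, ← span_close]
    exact h.eps_mem _ (hphi.2 hB)
  · have h1 := h.eps_mem _ (hphi.2 hB)
    rw [eps_close, span_close] at h1
    exact Set.mem_biUnion hB h1
  · rw [← eps_close B, ← eps_close B'] at hBB
    exact Finset.image_injective hinj (h.bijOn.injOn (hphi.2 hB) (hphi.2 hB') hBB)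
  · obtain ⟨B, hB, hxB⟩ := Set.mem_iUnion₂.1 hx
    rw [SetLike.mem_coe, ← span_close] at hxB
    obtain ⟨B', hB', rfl⟩ := h.bijOn.surjOn (Set.mem_biUnion (hphi.2 hB) hxB)
    have h0 := h.g_le _ (hphi.2 hB) B' hB' hxB none
    rw [g_none_image, Nat.le_zero] at h0
    have h1 : B' ⊆ (Finset.univ : Finset (Finset S)).image fun I => I.image some := by
      intro J hJ
      have h2 : none ∉ J := fun h2 =>
        Finset.card_ne_zero_of_mem (Finset.mem_filter.2 ⟨hJ, h2⟩) h0
      have h3 : J ⊆ (Finset.univ : Finset S).image some := by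
        rintro (_ | s) hs
        · exact absurd hs h2
        · simp
      obtain ⟨K, -, rfl⟩ := Finset.subset_image_iff.1 h3
      exact Finset.mem_image_of_mem _ (Finset.mem_univ K)
    obtain ⟨B'', -, rfl⟩ := Finset.subset_image_iff.1 h1
    exact ⟨B'', hphi.1 hB', (eps_close B'').symm⟩
  · rw [← eps_close, ← span_close] at hBB
    have := h.g_le _ (hphi.2 hB) _ (hphi.2 hB') hBB (some s)
    rwa [g_image (Option.some_injective S), g_image (Option.some_injective S)] at this

theorem LinearCase.perfect (h : D.LinearCase N) : D.Perfect := by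
  obtain ⟨c, hc⟩ := h.exists_isCircular
  refine Perfect.of_close (hc.perfect fun a ha => ?_)
  have h1 : ∑ s, (a none + a (some s)) • D.e s = 0 := by
    rw [Fintype.sum_option] at ha
    simp only [add_smul, Finset.sum_add_distrib, ← Finset.smul_sum]
    exact ha
  have h2 := Fintype.linearIndependent_iff.1 h.indep _ h1
  have h3 : ∀ s, a s = a none := by
    rintro (_ | s)
    · rfl
    · exact (CharTwo.add_eq_zero.1 (h2 s)).symm
  intro s t
  rw [h3 s, h3 t]

end Linear

/-! ### Collapsing a vertex and its two neighbours -/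

/-- `q` collapses the vertex `s` of the cycle `c` and its two neighbours to one vertex of the
cycle `c'`, and is injective otherwise. -/
structure IsCollapse {S S' : Type*} (c : Equiv.Perm S) (c' : Equiv.Perm S') (s : S) (q : S → S') :
    Prop where
  surj : Function.Surjective q
  fiber : ∀ t u, q t = q u ↔ t = u ∨ (Near c s t ∧ Near c s u)
  comm : ∀ t, t ≠ s → c t ≠ s → q (c t) = c' (q t)

namespace IsCollapse

variable {S S' : Type*} [Fintype S] [DecidableEq S] [Fintype S'] [DecidableEq S']
  {c : Equiv.Perm S} {c' : Equiv.Perm S'} {s : S} {q : S → S'}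

/-- The points `t` with `t ≠ s` and `c t ≠ s` are the last points of the fibres. -/
theorem exists_top (hq : IsCollapse c c' s q) (hc : OddCycle c) (i : S') :
    ∃ t, q t = i ∧ t ≠ s ∧ c t ≠ s := by
  obtain ⟨t, rfl⟩ := hq.surj i
  by_cases ht : Near c s t
  · exact ⟨c s, (hq.fiber _ _).2 (Or.inr ⟨Or.inr (Or.inl rfl), ht⟩), hc.apply_ne s,
      hc.apply_apply_ne s⟩
  · exact ⟨t, rfl, fun h => ht (Or.inl h), fun h => ht (Or.inr (Or.inr h.symm))⟩

theorem top_unique (hq : IsCollapse c c' s q) {t u : S} (ht : t ≠ s) (ht' : c t ≠ s)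
    (hu : u ≠ s) (hu' : c u ≠ s) (h : q t = q u) : t = u := by
  rcases (hq.fiber t u).1 h with h | ⟨h1, h2⟩
  · exact h
  · rcases h1 with h1 | h1 | h1
    · exact absurd h1 ht
    · rcases h2 with h2 | h2 | h2
      · exact absurd h2 hu
      · rw [h1, h2]
      · exact absurd h2.symm hu'
    · exact absurd h1.symm ht'

theorem apply_eq_of_not_top (hq : IsCollapse c c' s q) {t : S} (h : t = s ∨ c t = s) :
    q (c t) = q t := by
  rw [hq.fiber]
  rcases h with rfl | rfl
  · exact Or.inr ⟨Or.inr (Or.inl rfl), Or.inl rfl⟩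
  · exact Or.inr ⟨Or.inl rfl, Or.inr (Or.inr rfl)⟩

theorem near_apply (hq : IsCollapse c c' s q) {t u : S} (h : Near c t u) :
    Near c' (q t) (q u) := by
  have key : ∀ t, Near c' (q t) (q (c t)) := by
    intro t
    by_cases ht : t = s ∨ c t = s
    · exact Or.inl (hq.apply_eq_of_not_top ht)
    · push Not at ht
      exact Or.inr (Or.inl (hq.comm t ht.1 ht.2))
  rcases h with rfl | rfl | rfl
  · exact Or.inl rfl
  · exact key t
  · exact (key u).symm

theorem exists_near (hq : IsCollapse c c' s q) (hc : OddCycle c) {i j : S'} (h : Near c' i j) :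
    ∃ t u, q t = i ∧ q u = j ∧ Near c t u := by
  have key : ∀ i, ∃ t, q t = i ∧ q (c t) = c' i := by
    intro i
    obtain ⟨t, rfl, h1, h2⟩ := hq.exists_top hc i
    exact ⟨t, rfl, hq.comm t h1 h2⟩
  rcases h with rfl | rfl | rfl
  · obtain ⟨t, rfl⟩ := hq.surj j
    exact ⟨t, t, rfl, rfl, Or.inl rfl⟩
  · obtain ⟨t, h1, h2⟩ := key i
    exact ⟨t, c t, h1, h2, Or.inr (Or.inl rfl)⟩
  · obtain ⟨t, h1, h2⟩ := key j
    exact ⟨c t, t, h2, h1, Or.inr (Or.inr rfl)⟩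

theorem oddCycle (hq : IsCollapse c c' s q) (hc : OddCycle c)
    (hcard : Fintype.card S = Fintype.card S' + 2) (h5 : 5 ≤ Fintype.card S) : OddCycle c' := by
  refine ⟨fun A hA h => ?_, ?_, by omega⟩
  · have h1 := hc.trans (q ⁻¹' A) (hA.preimage hq.surj) fun t ht => by
      by_cases hts : t = s ∨ c t = s
      · rw [Set.mem_preimage, hq.apply_eq_of_not_top hts]; exact ht
      · push Not at hts
        rw [Set.mem_preimage, hq.comm t hts.1 hts.2]
        exact h _ ht
    exact Set.eq_univ_of_forall fun i => by
      obtain ⟨t, rfl⟩ := hq.surj i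
      have : t ∈ q ⁻¹' A := by rw [h1]; trivial
      exact this
  · have := hc.odd
    rw [Nat.odd_iff] at *
    omega

end IsCollapse

section Pre

variable {S S' : Type*} [Fintype S] [DecidableEq S] [DecidableEq S']

/-- The inverse image of a finite set, as a finite set. -/
def pre (q : S → S') (I : Finset S') : Finset S := Finset.univ.filter fun t => q t ∈ I

theorem mem_pre {q : S → S'} {I : Finset S'} {t : S} : t ∈ pre q I ↔ q t ∈ I := by simp [pre]

theorem pre_injective {q : S → S'} (hq : Function.Surjective q) :
    Function.Injective (pre q) := by
  intro I J h
  ext i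
  obtain ⟨t, rfl⟩ := hq i
  rw [← mem_pre, h, mem_pre]

end Pre

namespace IsCollapse

variable {S S' : Type*} [Fintype S] [DecidableEq S] [Fintype S'] [DecidableEq S']
  {c : Equiv.Perm S} {c' : Equiv.Perm S'} {s : S} {q : S → S'}

theorem apart_pre (hq : IsCollapse c c' s q) (hc : OddCycle c) {I J : Finset S'} :
    Apart c (pre q I) (pre q J) ↔ Apart c' I J := by
  constructor
  · intro h i hi j hj hn
    obtain ⟨t, u, rfl, rfl, htu⟩ := hq.exists_near hc hn
    exact h t (mem_pre.2 hi) u (mem_pre.2 hj) htu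
  · intro h t ht u hu hn
    exact h _ (mem_pre.1 ht) _ (mem_pre.1 hu) (hq.near_apply hn)

theorem inside_pre (hq : IsCollapse c c' s q) (hc : OddCycle c) {I J : Finset S'} :
    Inside c (pre q I) (pre q J) ↔ Inside c' I J := by
  constructor
  · intro h i hi j hn
    obtain ⟨t, u, rfl, rfl, htu⟩ := hq.exists_near hc hn
    exact mem_pre.1 (h t (mem_pre.2 hi) u htu)
  · intro h t ht u hn
    exact mem_pre.2 (h _ (mem_pre.1 ht) _ (hq.near_apply hn))

theorem isArc_pre (hq : IsCollapse c c' s q) (hc : OddCycle c) {I : Finset S'} :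
    IsArc c (pre q I) ↔ IsArc c' I := by
  have key : ∀ t, t ∈ pre q I → c t ∉ pre q I → t ≠ s ∧ c t ≠ s ∧ c' (q t) ∉ I := by
    intro t ht ht'
    rw [mem_pre] at ht ht'
    have h1 : ¬ (t = s ∨ c t = s) := fun h => ht' (by rwa [hq.apply_eq_of_not_top h])
    push Not at h1
    exact ⟨h1.1, h1.2, by rwa [← hq.comm t h1.1 h1.2]⟩
  constructor
  · rintro ⟨t, ⟨ht, ht'⟩, huniq⟩
    refine ⟨q t, ⟨mem_pre.1 ht, (key t ht ht').2.2⟩, fun j ⟨hj, hj'⟩ => ?_⟩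
    obtain ⟨u, rfl, hu, hu'⟩ := hq.exists_top hc j
    rw [huniq u ⟨mem_pre.2 hj, by rwa [mem_pre, hq.comm u hu hu']⟩]
  · rintro ⟨i, ⟨hi, hi'⟩, huniq⟩
    obtain ⟨t, rfl, ht, ht'⟩ := hq.exists_top hc i
    refine ⟨t, ⟨mem_pre.2 hi, by rwa [mem_pre, hq.comm t ht ht']⟩, fun u ⟨hu, hu'⟩ => ?_⟩
    obtain ⟨h1, h2, h3⟩ := key u hu hu'
    exact hq.top_unique h1 h2 ht ht' (huniq _ ⟨mem_pre.1 hu, h3⟩)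

/-- The fibres have one or three elements, so inverse images keep the parity of the cardinality. -/
theorem odd_card_pre (hq : IsCollapse c c' s q) (hc : OddCycle c) {I : Finset S'} :
    Odd (pre q I).card ↔ Odd I.card := by
  have h1 := Finset.card_filter_add_card_filter_not (s := pre q I) (fun t => t ≠ s ∧ c t ≠ s)
  have h2 : ((pre q I).filter fun t => t ≠ s ∧ c t ≠ s).card = I.card := by
    refine Finset.card_bij (fun t _ => q t) (fun t ht => ?_) (fun t ht u hu h => ?_)
      fun i hi => ?_
    · exact mem_pre.1 (Finset.mem_filter.1 ht).1
    · rw [Finset.mem_filter] at ht hu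
      exact hq.top_unique ht.2.1 ht.2.2 hu.2.1 hu.2.2 h
    · obtain ⟨t, rfl, ht⟩ := hq.exists_top hc i
      exact ⟨t, Finset.mem_filter.2 ⟨mem_pre.2 hi, ht⟩, rfl⟩
  have h3 : ((pre q I).filter fun t => ¬ (t ≠ s ∧ c t ≠ s)).card =
      if q s ∈ I then 2 else 0 := by
    have hqs : q (c⁻¹ s) = q s := by
      rw [hq.fiber]; exact Or.inr ⟨Or.inr (Or.inr (by simp)), Or.inl rfl⟩
    split_ifs with hs
    · have h4 : ((pre q I).filter fun t => ¬ (t ≠ s ∧ c t ≠ s)) = {s, c⁻¹ s} := by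
        ext t
        simp only [Finset.mem_filter, mem_pre, Finset.mem_insert, Finset.mem_singleton,
          Equiv.Perm.eq_inv_iff_eq]
        refine ⟨fun h => by tauto, fun h => ⟨?_, by tauto⟩⟩
        rcases h with rfl | h
        · exact hs
        · rw [Equiv.Perm.eq_inv_iff_eq.2 h, hqs]; exact hs
      rw [h4, Finset.card_pair]
      rw [Ne, Equiv.Perm.eq_inv_iff_eq]
      exact hc.apply_ne s
    · rw [Finset.card_eq_zero, Finset.filter_eq_empty_iff]
      intro t ht
      rw [mem_pre] at ht
      refine not_not.2 ⟨fun h => hs (h ▸ ht), fun h => hs ?_⟩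
      rwa [← hqs, ← Equiv.Perm.eq_inv_iff_eq.2 h]
  rw [h2, h3] at h1
  rw [← h1]
  split_ifs <;> simp [Nat.odd_add]

variable {B : Finset (Finset S)} {B' : Finset (Finset S')}

theorem singleton_notMem_image_pre (hq : IsCollapse c c' s q) (hc : OddCycle c) :
    {s} ∉ B'.image (pre q) := by
  intro h
  obtain ⟨I, -, hI⟩ := Finset.mem_image.1 h
  have h1 : s ∈ pre q I := by rw [hI]; simp
  have h2 : c s ∈ pre q I := by
    rw [mem_pre, hq.apply_eq_of_not_top (Or.inl rfl), ← mem_pre]; exact h1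
  rw [hI, Finset.mem_singleton] at h2
  exact hc.apply_ne s h2

theorem g_lift (hq : IsCollapse c c' s q) (hc : OddCycle c) (t : S) :
    g t (insert {s} (B'.image (pre q))) = g (q t) B' + if t = s then 1 else 0 := by
  have h1 : ((B'.image (pre q)).filter fun I => t ∈ I).card = g (q t) B' := by
    rw [Finset.filter_image, Finset.card_image_of_injective _ (pre_injective hq.surj)]
    simp only [mem_pre]
    rfl
  unfold g at *
  rw [Finset.filter_insert]
  split_ifs with h2 h3 h3
  · rw [Finset.card_insert_of_notMem, h1]
    exact fun h => hq.singleton_notMem_image_pre hc (Finset.mem_filter.1 h).1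
  · exact absurd (Finset.mem_singleton.1 h2) h3
  · exact absurd (Finset.mem_singleton.2 h3) h2
  · rw [h1, add_zero]

/-- Pulling back an admissible family and adding `{s}` gives an admissible family: the height
function is pulled back and raised by one at `s`. -/
theorem isAdmissible_lift (hq : IsCollapse c c' s q) (hc : OddCycle c)
    (hB : IsAdmissible c' B') : IsAdmissible c (insert {s} (B'.image (pre q))) := by
  have hs : ∀ I : Finset S', Apart c {s} (pre q I) ∨ Inside c {s} (pre q I) := by
    intro I
    have h1 : ∀ u, Near c s u → q u = q s := fun u hu =>
      (hq.fiber u s).2 (Or.inr ⟨hu, Or.inl rfl⟩)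
    by_cases h : q s ∈ I
    · right
      intro t ht u hu
      rw [Finset.mem_singleton] at ht
      subst ht
      rwa [mem_pre, h1 u hu]
    · left
      intro t ht u hu hn
      rw [Finset.mem_singleton] at ht
      subst ht
      rw [mem_pre, h1 u hn] at hu
      exact h hu
  refine ⟨⟨?_, ?_, ?_⟩, fun t => ?_⟩
  · simp only [Finset.forall_mem_insert, Finset.forall_mem_image, hq.isArc_pre hc]
    exact ⟨hc.isArc_singleton s, hB.arc⟩
  · simp only [Finset.forall_mem_insert, Finset.forall_mem_image, hq.odd_card_pre hc]
    exact ⟨by simp, hB.odd⟩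
  · simp only [Finset.forall_mem_insert, Finset.forall_mem_image, hq.apart_pre hc,
      hq.inside_pre hc, (pre_injective hq.surj).eq_iff]
    refine ⟨⟨by simp, fun I _ => ?_⟩, fun I hI => ⟨?_, hB.nested I hI⟩⟩
    · exact Or.inr ((hs I).imp_right Or.inl)
    · exact Or.inr ((hs I).imp Apart.symm Or.inr)
  · dsimp only
    rw [hq.g_lift hc, hq.g_lift hc]
    have hne := hc.apply_ne t
    by_cases h : t = s ∨ c t = s
    · rw [hq.apply_eq_of_not_top h]
      rcases h with rfl | rfl
      · simp [hne]
      · simp [hne.symm]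
    · push Not at h
      rw [hq.comm t h.1 h.2, if_neg h.1, if_neg h.2]
      exact hB.height (q t)

/-- Every admissible family containing `{s}` is obtained in this way: its other members contain
all or none of the points collapsed with `s`. -/
theorem exists_eq_lift (hq : IsCollapse c c' s q) (hc : OddCycle c) (hB : IsAdmissible c B)
    (hs : {s} ∈ B) : ∃ B', IsAdmissible c' B' ∧ B = insert {s} (B'.image (pre q)) := by
  have hpre : ∀ I ∈ B, I ≠ {s} → pre q (I.image q) = I := by
    intro I hI hne
    ext u
    rw [mem_pre, Finset.mem_image]
    refine ⟨fun ⟨t, ht, htu⟩ => ?_, fun h => ⟨u, h, rfl⟩⟩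
    rcases (hq.fiber t u).1 htu with rfl | ⟨h1, h2⟩
    · exact ht
    · rcases hB.nested {s} hs I hI with h | h | h | h
      · exact absurd h.symm hne
      · exact absurd h1 (h s (by simp) t ht)
      · exact h s (by simp) u h2
      · have h3 := Finset.mem_singleton.1 (h.subset ht)
        have h4 := Finset.mem_singleton.1 (h t ht (c t) (Or.inr (Or.inl rfl)))
        exact absurd (h4.trans h3.symm) (hc.apply_ne t)
  have hBeq : B = insert {s} (((B.erase {s}).image fun I => I.image q).image (pre q)) := by
    rw [Finset.image_image]
    have : (B.erase {s}).image (pre q ∘ fun I => I.image q) = B.erase {s} := by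
      conv_rhs => rw [← Finset.image_id (s := B.erase {s})]
      refine Finset.image_congr fun I hI => ?_
      rw [Finset.mem_coe, Finset.mem_erase] at hI
      exact hpre I hI.2 hI.1
    rw [this, Finset.insert_erase hs]
  refine ⟨(B.erase {s}).image fun I => I.image q, ⟨⟨?_, ?_, ?_⟩, fun i => ?_⟩, hBeq⟩
  · simp only [Finset.forall_mem_image, Finset.mem_erase, and_imp]
    intro I hne hI
    rw [← hq.isArc_pre hc, hpre I hI hne]
    exact hB.arc I hI
  · simp only [Finset.forall_mem_image, Finset.mem_erase, and_imp]
    intro I hne hI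
    rw [← hq.odd_card_pre hc, hpre I hI hne]
    exact hB.odd I hI
  · simp only [Finset.forall_mem_image, Finset.mem_erase, and_imp]
    intro I hne hI J hne' hJ
    rw [← hq.apart_pre hc, ← hq.inside_pre hc, ← hq.inside_pre hc,
      ← (pre_injective hq.surj).eq_iff, hpre I hI hne, hpre J hJ hne']
    exact hB.nested I hI J hJ
  · obtain ⟨t, rfl, h1, h2⟩ := hq.exists_top hc i
    have h3 := hB.height t
    dsimp only at h3 ⊢
    rw [hBeq, hq.g_lift hc, hq.g_lift hc, if_neg h1, if_neg h2, hq.comm t h1 h2] at h3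
    exact h3

end IsCollapse

section Singletons

variable {S : Type*} [Fintype S] [DecidableEq S] {c : Equiv.Perm S} {B : Finset (Finset S)}

theorem isAdmissible_empty : IsAdmissible c (∅ : Finset (Finset S)) :=
  ⟨⟨by simp, by simp, by simp⟩, fun t => Or.inl (by simp [g])⟩

theorem isAdmissible_singleton (hc : OddCycle c) (s : S) :
    IsAdmissible c ({{s}} : Finset (Finset S)) := by
  refine ⟨⟨?_, ?_, ?_⟩, fun t => ?_⟩
  · simpa using hc.isArc_singleton s
  · simp
  · simp
  · have hg : ∀ t, g t ({{s}} : Finset (Finset S)) = if t = s then 1 else 0 := by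
      intro t
      unfold g
      rw [Finset.filter_singleton]
      split_ifs with h1 h2 h2 <;> simp_all
    have := hc.apply_ne t
    dsimp only
    rw [hg, hg]
    split_ifs with h1 h2 h2 <;> simp_all

/-- A smallest member of an admissible family is a singleton: the height is constant and positive
on it, so that it contains no two neighbouring points. -/
theorem IsAdmissible.exists_singleton_mem (hB : IsAdmissible c B) (hne : B.Nonempty) :
    ∃ s, {s} ∈ B := by
  obtain ⟨I, hI, hmin⟩ := B.exists_min_image Finset.card hne
  obtain ⟨t, ht, -⟩ := (hB.arc I hI).exists
  have hmem : ∀ J ∈ B, ∀ x ∈ I, x ∈ J → I ⊆ J := by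
    intro J hJ x hx hxJ
    rcases hB.subset_or_subset hI hJ hx hxJ with h | h
    · exact h
    · rw [Finset.eq_of_subset_of_card_le h (hmin J hJ)]
  have hstep : ∀ x ∈ I, c x ∉ I := by
    intro x hx hcx
    have h1 : g x B = g (c x) B := congrArg Finset.card (Finset.filter_congr fun J hJ =>
      ⟨fun h => hmem J hJ x hx h hcx, fun h => hmem J hJ _ hcx h hx⟩)
    have h2 : 0 < g x B := Finset.card_pos.2 ⟨I, Finset.mem_filter.2 ⟨hI, hx⟩⟩
    have := hB.height x
    dsimp only at this
    omega
  refine ⟨t, ?_⟩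
  have : I = {t} := by
    ext x
    rw [Finset.mem_singleton]
    exact ⟨fun hx => (hB.arc I hI).exit_unique hx (hstep x hx) ht (hstep t ht), fun h => h ▸ ht⟩
  rwa [← this]

end Singletons

/-! ### The reduced triple -/

namespace IsCircular

variable {S V : Type*} [Fintype S] [DecidableEq S] [AddCommGroup V] [Module (ZMod 2) V]
  {D : SymplecticTriple S V} {c : Equiv.Perm S}

theorem form_eq (hD : D.IsCircular c) (s t : S) :
    D.form (D.e s) (D.e t) = if t = c s ∨ s = c t then 1 else 0 := by
  have h1 := hD.adj s t
  split_ifs with h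
  · exact (h1.2 h).2
  · rw [← h1] at h
    by_cases hst : s = t
    · rw [hst]; exact D.alt _
    · have h2 : ∀ x : ZMod 2, x ≠ 1 → x = 0 := by decide
      exact h2 _ fun h3 => h ⟨hst, h3⟩

theorem mem_hat (hD : D.IsCircular c) {s t : S} : t ∈ D.hat s ↔ Near c s t := by
  unfold hat Near
  rw [Finset.mem_union, Finset.mem_filter, Finset.mem_singleton, hD.form_eq]
  simp
  tauto

theorem inv_ne (hD : D.IsCircular c) (s : S) : c⁻¹ s ≠ s ∧ c⁻¹ s ≠ c s := by
  refine ⟨fun h => ?_, fun h => ?_⟩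
  · rw [Equiv.Perm.inv_eq_iff_eq] at h
    exact hD.apply_ne s h.symm
  · rw [Equiv.Perm.inv_eq_iff_eq] at h
    exact hD.apply_apply_ne s h.symm

theorem hat_eq (hD : D.IsCircular c) (s : S) : D.hat s = {c⁻¹ s, s, c s} := by
  ext t
  rw [hD.mem_hat]
  simp only [Near, Finset.mem_insert, Finset.mem_singleton, Equiv.Perm.eq_inv_iff_eq,
    eq_comm (a := s) (b := c t)]
  tauto

theorem card_hat (hD : D.IsCircular c) (s : S) : (D.hat s).card = 3 := by
  rw [hD.hat_eq, Finset.card_eq_three]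
  exact ⟨_, _, _, (hD.inv_ne s).1, (hD.inv_ne s).2, (hD.apply_ne s).symm, rfl⟩

theorem vec_hat (hD : D.IsCircular c) (s : S) :
    D.vec (D.hat s) = D.e (c⁻¹ s) + (D.e s + D.e (c s)) := by
  unfold vec
  rw [hD.hat_eq, Finset.sum_insert, Finset.sum_pair (hD.apply_ne s).symm]
  rw [Finset.mem_insert, Finset.mem_singleton, not_or]
  exact hD.inv_ne s

/-- The map from `S` to the index set of the reduced triple. -/
def toReduced (D : SymplecticTriple S V) (s t : S) : Option {t : S // t ∉ D.hat s} :=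
  if h : t ∈ D.hat s then none else some ⟨t, h⟩

/-- The last point of a fibre of `toReduced`. -/
def ofReduced (D : SymplecticTriple S V) (c : Equiv.Perm S) (s : S)
    (j : Option {t : S // t ∉ D.hat s}) : S := j.elim (c s) Subtype.val

theorem toReduced_eq_none {s t : S} : toReduced D s t = none ↔ t ∈ D.hat s := by
  unfold toReduced; split_ifs with h <;> simp [h]

theorem toReduced_eq_some {s t : S} {u : {t : S // t ∉ D.hat s}} :
    toReduced D s t = some u ↔ t = u.1 := by
  unfold toReduced
  split_ifs with h
  · simp only [false_iff]
    exact fun h' => u.2 (h' ▸ h)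
  · rw [Option.some_inj, Subtype.ext_iff]

theorem toReduced_ofReduced (hD : D.IsCircular c) (s : S) (j : Option {t : S // t ∉ D.hat s}) :
    toReduced D s (ofReduced D c s j) = j := by
  rcases j with _ | t
  · exact toReduced_eq_none.2 (hD.mem_hat.2 (Or.inr (Or.inl rfl)))
  · exact toReduced_eq_some.2 rfl

theorem ofReduced_ne (hD : D.IsCircular c) (s : S) (j : Option {t : S // t ∉ D.hat s}) :
    ofReduced D c s j ≠ s ∧ c (ofReduced D c s j) ≠ s := by
  rcases j with _ | ⟨t, ht⟩
  · exact ⟨hD.apply_ne s, hD.apply_apply_ne s⟩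
  · rw [hD.mem_hat] at ht
    exact ⟨fun h => ht (Or.inl h), fun h => ht (Or.inr (Or.inr h.symm))⟩

theorem toReduced_fiber (hD : D.IsCircular c) (s t u : S) :
    toReduced D s t = toReduced D s u ↔ t = u ∨ (Near c s t ∧ Near c s u) := by
  rw [← hD.mem_hat, ← hD.mem_hat]
  by_cases hu : u ∈ D.hat s
  · rw [toReduced_eq_none.2 hu, toReduced_eq_none]
    refine ⟨fun h => Or.inr ⟨h, hu⟩, ?_⟩
    rintro (rfl | h)
    exacts [hu, h.1]
  · have h1 : toReduced D s u = some ⟨u, hu⟩ := toReduced_eq_some.2 rfl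
    rw [h1, toReduced_eq_some]
    tauto

/-- The reduced index set inherits a cyclic orientation. -/
theorem exists_isCollapse (hD : D.IsCircular c) (s : S) :
    ∃ c' : Equiv.Perm (Option {t : S // t ∉ D.hat s}), IsCollapse c c' s (toReduced D s) := by
  have hinj : Function.Injective fun j => toReduced D s (c (ofReduced D c s j)) := by
    intro i j hij
    have hi := hD.ofReduced_ne s i
    have hj := hD.ofReduced_ne s j
    have : ofReduced D c s i = ofReduced D c s j := by
      rcases (hD.toReduced_fiber s _ _).1 hij with h | ⟨h1, h2⟩
      · exact c.injective h
      · have key : ∀ x, x ≠ s → c x ≠ s → Near c s (c x) → s = c (c x) := by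
          rintro x hx hx' (h | h | h)
          · exact absurd h hx'
          · exact absurd (c.injective h) hx
          · exact h
        exact c.injective (c.injective ((key _ hi.1 hi.2 h1).symm.trans (key _ hj.1 hj.2 h2)))
    rw [← hD.toReduced_ofReduced s i, this, hD.toReduced_ofReduced]
  refine ⟨Equiv.ofBijective _ (Finite.injective_iff_bijective.1 hinj), ⟨fun j =>
    ⟨_, hD.toReduced_ofReduced s j⟩, hD.toReduced_fiber s, fun t ht ht' => ?_⟩⟩
  rw [Equiv.ofBijective_apply]
  have h1 := hD.ofReduced_ne s (toReduced D s t)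
  rcases (hD.toReduced_fiber s _ _).1 (hD.toReduced_ofReduced s (toReduced D s t)) with
    h | ⟨h2, h3⟩
  · rw [h]
  · have key : ∀ x, x ≠ s → c x ≠ s → Near c s x → x = c s := by
      rintro x hx hx' (h | h | h)
      · exact absurd h hx
      · exact h
      · exact absurd h.symm hx'
    rw [key _ h1.1 h1.2 h2, key t ht ht' h3]

/-- The vector of `e_s^⊥` whose image is the basis vector of the reduced triple indexed by `j`. -/
def reducedVec (D : SymplecticTriple S V) (s : S) (j : Option {t : S // t ∉ D.hat s}) : V :=
  j.elim (D.vec (D.hat s)) fun t => D.e t.1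

theorem reducedVec_eq (s : S) (j : Option {t : S // t ∉ D.hat s}) :
    reducedVec D s j = D.vec (pre (toReduced D s) {j}) := by
  have h1 : pre (toReduced D s) {j} = j.elim (D.hat s) fun t => {t.1} := by
    ext t
    rw [mem_pre, Finset.mem_singleton]
    rcases j with _ | u
    · exact toReduced_eq_none
    · rw [toReduced_eq_some]; simp
  rw [h1]
  rcases j with _ | u
  · rfl
  · simp [reducedVec, vec]

theorem reducedVec_mem (hD : D.IsCircular c) (s : S) (j : Option {t : S // t ∉ D.hat s}) :
    reducedVec D s j ∈ D.perp s := by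
  unfold perp
  rw [LinearMap.mem_ker, LinearMap.flip_apply]
  rcases j with _ | ⟨t, ht⟩
  · change D.form (D.vec (D.hat s)) (D.e s) = 0
    rw [hD.vec_hat]
    simp only [map_add, LinearMap.add_apply, hD.form_eq]
    simp [(hD.apply_ne s).symm]
    rfl
  · rw [hD.mem_hat] at ht
    change D.form (D.e t) (D.e s) = 0
    rw [hD.form_eq, if_neg]
    rintro (h | h)
    · exact ht (Or.inr (Or.inr h))
    · exact ht (Or.inr (Or.inl h))

theorem reduce_e (hD : D.IsCircular c) (s : S) (j : Option {t : S // t ∉ D.hat s}) :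
    (D.reduce s).e j = (D.line s).mkQ ⟨reducedVec D s j, hD.reducedVec_mem s j⟩ :=
  dif_pos (hD.reducedVec_mem s j)

theorem reduce_form (hD : D.IsCircular c) (s : S) (i j : Option {t : S // t ∉ D.hat s}) :
    (D.reduce s).form ((D.reduce s).e i) ((D.reduce s).e j) =
      D.form (reducedVec D s i) (reducedVec D s j) := by
  rw [hD.reduce_e, hD.reduce_e]
  rfl

theorem card_reduced (hD : D.IsCircular c) (s : S) :
    Fintype.card S = Fintype.card (Option {t : S // t ∉ D.hat s}) + 2 := by
  have h1 : Fintype.card {t : S // t ∉ D.hat s} = Fintype.card S - 3 := by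
    rw [Fintype.card_subtype_compl, Fintype.card_coe, hD.card_hat]
  rw [Fintype.card_option, h1]
  have := hD.three_le
  omega

/-- The reduced triple of a circular triple with at least five vertices is circular. -/
theorem reduce_isCircular (hD : D.IsCircular c) (s : S)
    {c' : Equiv.Perm (Option {t : S // t ∉ D.hat s})} (hc' : IsCollapse c c' s (toReduced D s))
    (h5 : 5 ≤ Fintype.card S) : (D.reduce s).IsCircular c' := by
  have hodd := hc'.oddCycle hD.toOddCycle (hD.card_reduced s) h5
  have hpow : ∀ n, 0 < n → n < 5 → (c ^ n) s ≠ s := fun n h0 hn h =>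
    h0.ne' (hD.pow_inj s (i := n) (j := 0) (by omega) (by omega) (by simpa using h))
  have h3 : c (c (c s)) ≠ s := hpow 3 (by omega) (by omega)
  have h4 : c (c (c (c s))) ≠ s := hpow 4 (by omega) (by omega)
  have hccs : c (c s) ∉ D.hat s := by
    rw [hD.mem_hat]
    rintro (h | h | h)
    · exact hD.apply_apply_ne s h
    · exact hD.apply_ne s (c.injective h)
    · exact h3 h.symm
  have c'none : c' none = some ⟨c (c s), hccs⟩ := by
    rw [← toReduced_eq_none.2 (hD.mem_hat.2 (Or.inr (Or.inl rfl)) : c s ∈ D.hat s),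
      ← hc'.comm _ (hD.apply_ne s) (hD.apply_apply_ne s)]
    exact toReduced_eq_some.2 rfl
  have c'some : ∀ t : {t : S // t ∉ D.hat s}, c' (some t) = toReduced D s (c t.1) := by
    rintro ⟨t, ht⟩
    have h1 := hD.ofReduced_ne s (some ⟨t, ht⟩)
    rw [hc'.comm t h1.1 h1.2]
    congr 1
    exact (toReduced_eq_some.2 rfl).symm
  -- the neighbours of the collapsed vertex
  have hnone : ∀ t : {t : S // t ∉ D.hat s}, D.form (D.vec (D.hat s)) (D.e t.1) = 1 ↔
      some t = c' none ∨ none = c' (some t) := by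
    rintro ⟨t, ht⟩
    have ht' := ht
    rw [hD.mem_hat] at ht'
    unfold Near at ht'
    push Not at ht'
    obtain ⟨t1, t2, t3⟩ := ht'
    rw [c'none, c'some, Option.some_inj, Subtype.mk.injEq, eq_comm (a := none), toReduced_eq_none,
      hD.mem_hat, hD.vec_hat]
    have e1 : ¬ (c t = s) := fun h => t3 h.symm
    have e2 : ¬ (c t = c s) := fun h => t1 (c.injective h)
    have e3 : c (c⁻¹ s) = s := by simp
    simp only [map_add, LinearMap.add_apply, hD.form_eq, Near, Equiv.Perm.inv_eq_iff_eq,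
      e1, e2, e3, t1, t2, t3, false_or, or_false, if_false, zero_add,
      eq_comm (a := c s) (b := c t)]
    by_cases h6 : s = c (c t)
    · have h7 : t ≠ c (c s) := fun h => h4 (by rw [← h]; exact h6.symm)
      simp [← h6, h7]
    · by_cases h7 : t = c (c s)
      · have h8 := h4.symm
        simp [h7, h8]
      · simp [h6, h7]
  have hcomm : ∀ x y, D.form x y = 1 → D.form y x = 1 := by
    intro x y h
    have h1 := D.alt.neg x y
    rwa [ZMod.neg_eq_self_mod_two, h, eq_comm] at h1
  refine ⟨hodd, fun i j => ?_⟩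
  change (i ≠ j ∧ _ = _) ↔ _
  rw [hD.reduce_form]
  rcases i with _ | ⟨t, ht⟩ <;> rcases j with _ | ⟨u, hu⟩
  · have := hodd.apply_ne none
    simp [this.symm]
  · change (_ ∧ D.form (D.vec (D.hat s)) (D.e u) = 1) ↔ _
    rw [hnone ⟨u, hu⟩]
    simp
  · change (_ ∧ D.form (D.e t) (D.vec (D.hat s)) = 1) ↔ _
    rw [or_comm, ← hnone ⟨t, ht⟩]
    exact ⟨fun h => hcomm _ _ h.2, fun h => ⟨by simp, hcomm _ _ h⟩⟩
  · change (_ ∧ D.form (D.e t) (D.e u) = 1) ↔ _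
    have h6 := hD.apply_ne t
    have h7 : some ⟨u, hu⟩ = c' (some ⟨t, ht⟩) ↔ u = c t := by
      rw [c'some, eq_comm, toReduced_eq_some, eq_comm]
    have h8 : some ⟨t, ht⟩ = c' (some ⟨u, hu⟩) ↔ t = c u := by
      rw [c'some, eq_comm, toReduced_eq_some, eq_comm]
    rw [hD.form_eq, h7, h8]
    simp only [ne_eq, Option.some_inj, Subtype.mk.injEq, ite_eq_left_iff, zero_ne_one, imp_false,
      not_not, and_iff_right_iff_imp]
    rintro (h | h) rfl
    · exact h6 h.symm
    · exact h6 h.symm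

theorem reduce_vec (hD : D.IsCircular c) (s : S) (I : Finset (Option {t : S // t ∉ D.hat s})) :
    ∃ h : D.vec (pre (toReduced D s) I) ∈ D.perp s,
      (D.reduce s).vec I = (D.line s).mkQ ⟨D.vec (pre (toReduced D s) I), h⟩ := by
  have h1 : D.vec (pre (toReduced D s) I) = ∑ j ∈ I, reducedVec D s j := by
    simp only [reducedVec_eq, vec]
    rw [← Finset.sum_fiberwise_of_maps_to (s := pre (toReduced D s) I) (t := I)
      (g := toReduced D s) fun t ht => mem_pre.1 ht]
    refine Finset.sum_congr rfl fun j hj => Finset.sum_congr ?_ fun _ _ => rfl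
    ext t
    rw [Finset.mem_filter, mem_pre, mem_pre, Finset.mem_singleton]
    exact ⟨fun h => h.2, fun h => ⟨h ▸ hj, h⟩⟩
  have h2 : D.vec (pre (toReduced D s) I) ∈ D.perp s := by
    rw [h1]; exact Submodule.sum_mem _ fun j _ => hD.reducedVec_mem s j
  refine ⟨h2, ?_⟩
  have h3 : (⟨D.vec (pre (toReduced D s) I), h2⟩ : D.perp s) =
      ∑ j ∈ I, ⟨reducedVec D s j, hD.reducedVec_mem s j⟩ := by
    apply Subtype.ext
    rw [Submodule.coe_sum]
    exact h1
  rw [h3, map_sum]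
  unfold vec
  simp only [hD.reduce_e]

/-- The inverse image under `p̄_s` of the space attached to a family of the reduced triple. -/
theorem pull_span (hD : D.IsCircular c) (s : S)
    (B : Finset (Finset (Option {t : S // t ∉ D.hat s}))) :
    D.pull s ((D.reduce s).span B) = D.span (insert {s} (B.image (pre (toReduced D s)))) := by
  choose h hvec using hD.reduce_vec s
  have h1 : (D.reduce s).span B = (Submodule.span (ZMod 2)
      ((fun I => (⟨D.vec (pre (toReduced D s) I), h I⟩ : D.perp s)) '' B)).map (D.line s).mkQ := by
    unfold span
    rw [Submodule.map_span, Set.image_image]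
    simp only [hvec]
  have hs : D.e s ∈ D.perp s := by
    unfold perp
    rw [LinearMap.mem_ker, LinearMap.flip_apply]
    exact D.alt _
  have h2 : (D.line s).map (D.perp s).subtype = Submodule.span (ZMod 2) {D.e s} := by
    unfold line
    rw [Submodule.map_comap_subtype]
    exact inf_eq_right.2 ((Submodule.span_singleton_le_iff_mem _ _).2 hs)
  unfold pull
  rw [h1, Submodule.comap_map_mkQ, Submodule.map_sup, h2, Submodule.map_span, Set.image_image]
  unfold span
  rw [Finset.coe_insert, Set.image_insert_eq, Submodule.span_insert, Finset.coe_image,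
    Set.image_image]
  simp [vec]

end IsCircular

/-! ### The inductively defined family -/

/-- The family `𝓕` consists of the spaces attached to the elements of `φ`. In the inductive step,
a nonempty family has a singleton `{s}` as a member, and collapsing the neighbourhood of `s`
identifies the families containing `{s}` with those of the reduced triple. -/
theorem IsCircular.family_eq (k : ℕ) {S : Type v} {V : Type u} [Fintype S] [DecidableEq S]
    [AddCommGroup V] [Module (ZMod 2) V] {D : SymplecticTriple S V} {c : Equiv.Perm S}
    (hD : D.IsCircular c) (hcard : Fintype.card S = 2 * k + 3) :
    D.family k = D.span '' D.phi := by
  have hempty : ⊥ ∈ D.span '' D.phi :=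
    ⟨∅, hD.mem_phi_iff.2 isAdmissible_empty, by simp [span]⟩
  induction k generalizing S V with
  | zero =>
    have hpull : ∀ s, D.pull s ⊥ = D.span {{s}} := fun s => by
      have := hD.pull_span s ∅
      simpa [span] using this
    ext L
    change (L = ⊥ ∨ ∃ s, L = D.pull s ⊥) ↔ _
    constructor
    · rintro (rfl | ⟨s, rfl⟩)
      · exact hempty
      · rw [hpull]
        exact ⟨_, hD.mem_phi_iff.2 (isAdmissible_singleton hD.toOddCycle s), rfl⟩
    · rintro ⟨B, hB, rfl⟩
      rw [hD.mem_phi_iff] at hB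
      rcases B.eq_empty_or_nonempty with rfl | hne
      · left; simp [span]
      · right
        obtain ⟨s, hs⟩ := hB.exists_singleton_mem hne
        refine ⟨s, ?_⟩
        rw [hpull]
        congr 1
        refine Finset.eq_singleton_iff_unique_mem.2 ⟨hs, fun I hI => ?_⟩
        have hnear : ∀ t, Near c s t := by
          intro t
          rw [← hD.mem_hat, Finset.eq_univ_of_card (D.hat s) (by rw [hD.card_hat, hcard])]
          exact Finset.mem_univ t
        obtain ⟨t, ht, ht'⟩ := (hB.arc I hI).exists
        rcases hB.nested _ hs I hI with h | h | h | h
        · exact h.symm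
        · exact absurd (hnear t) (h s (by simp) t ht)
        · exact absurd (h s (by simp) _ (hnear (c t))) ht'
        · exact absurd ((Finset.mem_singleton.1 (h t ht _ (Or.inr (Or.inl rfl)))).trans
            (Finset.mem_singleton.1 (h.subset ht)).symm) (hD.apply_ne t)
  | succ k ih =>
    have hred : ∀ s, ∃ c', IsCollapse c c' s (toReduced D s) ∧ (D.reduce s).IsCircular c' ∧
        (D.reduce s).family k = (D.reduce s).span '' (D.reduce s).phi := by
      intro s
      obtain ⟨c', hc'⟩ := hD.exists_isCollapse s
      have h1 := hD.reduce_isCircular s hc' (by omega)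
      have h2 := hD.card_reduced s
      exact ⟨c', hc', h1, ih h1 (by omega)
        ⟨∅, h1.mem_phi_iff.2 isAdmissible_empty, by simp [span]⟩⟩
    ext L
    change (L = ⊥ ∨ ∃ s, ∃ L' ∈ (D.reduce s).family k, L = D.pull s L') ↔ _
    constructor
    · rintro (rfl | ⟨s, L', hL', rfl⟩)
      · exact hempty
      · obtain ⟨c', hc', hcirc, hfam⟩ := hred s
        rw [hfam] at hL'
        obtain ⟨B, hB, rfl⟩ := hL'
        rw [hcirc.mem_phi_iff] at hB
        exact ⟨_, hD.mem_phi_iff.2 (hc'.isAdmissible_lift hD.toOddCycle hB),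
          (hD.pull_span s B).symm⟩
    · rintro ⟨B, hB, rfl⟩
      rw [hD.mem_phi_iff] at hB
      rcases B.eq_empty_or_nonempty with rfl | hne
      · left; simp [span]
      · right
        obtain ⟨s, hs⟩ := hB.exists_singleton_mem hne
        obtain ⟨c', hc', hcirc, hfam⟩ := hred s
        obtain ⟨B', hB', rfl⟩ := hc'.exists_eq_lift hD.toOddCycle hB hs
        refine ⟨s, _, ?_, (hD.pull_span s B').symm⟩
        rw [hfam]
        exact ⟨B', hcirc.mem_phi_iff.2 hB', rfl⟩

/-! ### The bijection between subspaces and vectors -/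

section Bijection

variable {S V : Type*} [Fintype S] [DecidableEq S] [AddCommGroup V] [Module (ZMod 2) V]
  {D : SymplecticTriple S V}

theorem Perfect.injOn_span (h : D.Perfect) : Set.InjOn D.span D.phi := by
  intro B hB B' hB' heq
  rw [← Finset.coe_inj, h.eq_members B hB, h.eq_members B' hB', heq]

/-- Uniqueness is a triangularity argument: a bijection `f` with `f(L) ∈ L` differs from
`L_B ↦ ε(B)` by a permutation `π` of `φ(V)` with `ε(π B) ∈ L_B`, hence with `g(π B) ≤ g(B)`.
Summing over all `B` gives equality, and `g` determines `ε`. -/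
theorem Perfect.exists_unique_bijection (h : D.Perfect) (hV : D.V0 = Set.univ)
    {F : Set (Submodule (ZMod 2) V)} (hF : Set.BijOn D.span D.phi F) :
    ∃ f : F → V, (Function.Bijective f ∧ ∀ L, f L ∈ L.1) ∧
      (∀ f', Function.Bijective f' ∧ (∀ L, f' L ∈ L.1) → f' = f) ∧
      ∀ B ∈ D.phi, ∀ hB : D.span B ∈ F, f ⟨D.span B, hB⟩ = D.eps B := by
  let e₁ : D.phi ≃ F := hF.equiv
  have he₁ : ∀ B : D.phi, (e₁ B).1 = D.span B.1 := fun B => rfl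
  have hbij : Function.Bijective fun B : D.phi => D.eps B.1 := by
    refine ⟨fun B B' hBB => Subtype.ext (h.bijOn.injOn B.2 B'.2 hBB), fun x => ?_⟩
    obtain ⟨B, hB, rfl⟩ := h.bijOn.surjOn (hV ▸ Set.mem_univ x)
    exact ⟨⟨B, hB⟩, rfl⟩
  let e₂ : D.phi ≃ V := Equiv.ofBijective _ hbij
  have he₂ : ∀ B : D.phi, e₂ B = D.eps B.1 := fun B => rfl
  have hf : ∀ B : D.phi, e₂ (e₁.symm (e₁ B)) = D.eps B.1 := fun B => by
    rw [Equiv.symm_apply_apply, he₂]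
  refine ⟨fun L => e₂ (e₁.symm L), ⟨(e₁.symm.trans e₂).bijective, fun L => ?_⟩,
    fun f' ⟨hf', hmem⟩ => ?_, fun B hB _ => hf ⟨B, hB⟩⟩
  · obtain ⟨B, rfl⟩ := e₁.surjective L
    beta_reduce
    rw [hf, he₁]
    exact h.eps_mem _ B.2
  · have := Fintype.ofFinite D.phi
    let π : D.phi ≃ D.phi := (e₁.trans (Equiv.ofBijective f' hf')).trans e₂.symm
    have hπ : ∀ B, D.eps (π B).1 = f' (e₁ B) := fun B => e₂.apply_symm_apply _
    have hle : ∀ s B, g s (π B).1 ≤ g s B.1 := fun s B =>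
      h.g_le _ B.2 _ (π B).2 (by rw [hπ]; exact hmem (e₁ B)) s
    have heq : ∀ s B, g s (π B).1 = g s B.1 := fun s B =>
      (Finset.sum_eq_sum_iff_of_le (s := Finset.univ) fun B _ => hle s B).1
        (Equiv.sum_comp π fun B => g s B.1) B (Finset.mem_univ B)
    funext L
    obtain ⟨B, rfl⟩ := e₁.surjective L
    rw [hf, ← hπ]
    unfold eps
    simp only [heq]

theorem CyclicCase.bijOn_span {N : ℕ} (h : D.CyclicCase N) :
    Set.BijOn h.bar.span h.bar.phi (h.bar.family ((N - 3) / 2)) := by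
  obtain ⟨c, hc⟩ := h.exists_isCircular
  have hcard : Fintype.card S = 2 * ((N - 3) / 2) + 3 := by
    obtain ⟨ψ⟩ := h.iso
    have h1 : Fintype.card S = N := by rw [Fintype.card_congr ψ.toEquiv, Fintype.card_fin]
    have h2 := h.three_le
    have h3 := Nat.odd_iff.1 h.odd
    omega
  rw [(h.bar_isCircular hc).family_eq _ hcard]
  exact h.bar_perfect.injOn_span.bijOn_image

end Bijection

end SymplecticTriple

theorem theorem1p4 {S : Type*} {V : Type*} [Fintype S] [DecidableEq S] [AddCommGroup V]
    [Module (ZMod 2) V] (D : SymplecticTriple S V) (N : ℕ) :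
    -- case (a)
    (D.LinearCase N → D.Perfect) ∧
    -- case (b)
    (D.CyclicCase N → D.Perfect) ∧
    -- case (c)
    (∀ h : D.CyclicCase N,
      h.bar.Perfect ∧
      h.bar.V0 = Set.univ ∧
      -- the description of the inductively defined family
      Set.BijOn h.bar.span h.bar.phi (h.bar.family ((N - 3) / 2)) ∧
      -- the description of its bijection to the quotient space
      (∃ f : h.bar.family ((N - 3) / 2) →
            V ⧸ Submodule.span (ZMod 2) {D.vec Finset.univ},
        (Function.Bijective f ∧ ∀ L, f L ∈ L.1) ∧
        (∀ f', Function.Bijective f' ∧ (∀ L, f' L ∈ L.1) → f' = f) ∧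
        ∀ B ∈ h.bar.phi, ∀ hB : h.bar.span B ∈ h.bar.family ((N - 3) / 2),
          f ⟨h.bar.span B, hB⟩ = h.bar.eps B) ∧
      -- the symmetry under the automorphism group of the graph, acting on the quotient space
      (∀ σ : h.bar.graph ≃g h.bar.graph,
        ∃ T : (V ⧸ Submodule.span (ZMod 2) {D.vec Finset.univ}) ≃ₗ[ZMod 2]
            (V ⧸ Submodule.span (ZMod 2) {D.vec Finset.univ}),
          (∀ s, T (h.bar.e s) = h.bar.e (σ s)) ∧
          ∀ B ∈ h.bar.phi,
            B.image (fun I => I.image σ) ∈ h.bar.phi ∧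
            h.bar.span (B.image (fun I => I.image σ)) =
              (h.bar.span B).map T.toLinearMap ∧
            h.bar.eps (B.image (fun I => I.image σ)) = T (h.bar.eps B))) := by
  refine ⟨fun h => h.perfect, fun h => h.perfect, fun h => ⟨h.bar_perfect, h.bar_V0, h.bijOn_span,
    h.bar_perfect.exists_unique_bijection h.bar_V0 h.bijOn_span, fun σ => ?_⟩⟩
  obtain ⟨T, hT⟩ := h.exists_equiv σ.toEquiv
  exact ⟨T, hT, fun B hB => ⟨(SymplecticTriple.image_mem_phi σ.toEmbedding).2 hB,
    SymplecticTriple.span_image (T := T.toLinearMap) σ.injective hT B,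
    SymplecticTriple.eps_image_equiv (T := T.toLinearMap) σ.toEquiv hT B⟩⟩
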